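/- **Conventions.** For a Noetherian local ring $R$, an ideal $\mathfrak a$ primary to its maximal ideal, and a finitely generated $R$-module $M$ of dimension $d$, write $$\sum_{n\ge 0}\lambda_R(M/\mathfrak a^{n+1}M)\,z^n=\frac{h(z)}{(1-z)^{d+1}},\qquad h\in\mathbb Z[z],$$ and let $e_i^{\mathfrak a}(M)=h^{(i)}(1)/i!$ be the Hilbert coefficients of $M$ with respect to $\mathfrak a$; for $0\le i\le d$ they are the integers satisfying $\lambda_R(M/\mathfrak a^{n+1}M)=\sum_{i=0}^{d}(-1)^i e_i^{\mathfrak a}(M)\binom{n+d-i}{d-i}$ for $n\gg 0$. Here $\lambda_R$ denotes length over $R$. An ideal $\mathfrak a\subseteq \mathfrak b$ is a reduction of $\mathfrak b$ if $\mathfrak a\mathfrak b^n=\mathfrak b^{n+1}$ for some $n$. **Theorem.** Let $(A,\mathfrak m)\to(B,\mathfrak n)$ be a local homomorphism of Cohen–Macaulay local rings such that $B$ is a finite $A$-module and $\dim A=\dim B$. Let $\delta=\dim_{A/\mathfrak m}B/\mathfrak n$. Let $I\subset A$ be an $\mathfrak m$-primary ideal and $J\subset B$ an $\mathfrak n$-primary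 ideal such that $IB$ is a reduction of $J$. Let $e_1^I(B)$ be the first Hilbert coefficient of the $A$-module $B$ with respect to $I$, and $e_1^J(B)$ that of the $B$-module $B$ with respect to $J$. Suppose that $Gr_I(B)=\bigoplus_{n\ge 0}I^nB/I^{n+1}B$ is Cohen–Macaulay. Then $$\delta\, e_1^J(B)\ \ge\ e_1^I(B)+\lambda_A(J/IB).$$ If equality holds, then $Gr_J(B)=\bigoplus_{n\ge 0}J^n/J^{n+1}$ is also Cohen–Macaulay. -/

import Mathlib

namespace RelHilbert

open IsLocalRing

/-- A local ring `R` is Cohen-Macaulay if it is Noetherian and its depth equals its Krull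
dimension, i.e. the maximal ideal contains an `R`-regular sequence of length `dim R`
(regular sequences in the maximal ideal are never longer than `dim R`). -/
def IsCohenMacaulayLocalRing (R : Type*) [CommRing R] [IsLocalRing R] : Prop :=
  IsNoetherianRing R ∧
    ∃ rs : List R, (∀ r ∈ rs, r ∈ maximalIdeal R) ∧ RingTheory.Sequence.IsRegular R rs ∧
      (rs.length : WithBot ℕ∞) = ringKrullDim R

/-- A commutative ring is Cohen-Macaulay if it is Noetherian and its localizations at all
maximal ideals are Cohen-Macaulay local rings. -/
def IsCohenMacaulayRing (R : Type*) [CommRing R] : Prop :=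
  IsNoetherianRing R ∧
    ∀ (p : Ideal R) [p.IsMaximal], IsCohenMacaulayLocalRing (Localization.AtPrime p)

/-- The associated graded ring `Gr_𝔞(R) = ⨁ₙ 𝔞ⁿ / 𝔞ⁿ⁺¹`, as the quotient
`R[𝔞t] / 𝔞 R[𝔞t]` of the Rees algebra. -/
abbrev AssociatedGraded {R : Type*} [CommRing R] (𝔞 : Ideal R) : Type _ :=
  reesAlgebra 𝔞 ⧸ 𝔞.map (algebraMap R (reesAlgebra 𝔞))

/-- `𝔮` is primary to the maximal ideal of the local ring `R`. -/
def IsPrimaryToMaximal {R : Type*} [CommRing R] [IsLocalRing R] (𝔮 : Ideal R) : Prop :=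
  𝔮.IsPrimary ∧ 𝔮.radical = maximalIdeal R

/-- `𝔞` is a reduction of `𝔟`: `𝔞 ⊆ 𝔟` and `𝔞 𝔟ⁿ = 𝔟ⁿ⁺¹` for some `n`
(equivalently, for all large `n`). -/
def IsReduction {R : Type*} [CommRing R] (𝔞 𝔟 : Ideal R) : Prop :=
  𝔞 ≤ 𝔟 ∧ ∃ n : ℕ, 𝔞 * 𝔟 ^ n = 𝔟 ^ (n + 1)

/-- The Hilbert-Samuel function `n ↦ λ_R(M / 𝔞ⁿ⁺¹ M)`. -/
noncomputable def hilbertSamuel {R : Type*} [CommRing R] (𝔞 : Ideal R)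
    (M : Type*) [AddCommGroup M] [Module R M] (n : ℕ) : ℕ :=
  (Module.length R (M ⧸ (𝔞 ^ (n + 1) • (⊤ : Submodule R M)))).toNat

/-- The `h`-polynomial `h(z)` of `M` with respect to `𝔞`, where `d = dim M`. It is defined by
`∑ₙ λ_R(M / 𝔞ⁿ⁺¹ M) zⁿ = h(z) / (1 - z)ᵈ⁺¹` as a power series; if `R` is Noetherian local, `𝔞` is
primary to the maximal ideal and `M` is finitely generated of dimension `d`, then it is
a polynomial. -/
noncomputable def hSeries {R : Type*} [CommRing R] (𝔞 : Ideal R)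
    (M : Type*) [AddCommGroup M] [Module R M] (d : ℕ) : PowerSeries ℤ :=
  (1 - PowerSeries.X) ^ (d + 1) * PowerSeries.mk fun n => (hilbertSamuel 𝔞 M n : ℤ)

/-- The Hilbert coefficient `e_i^𝔞(M) = h⁽ⁱ⁾(1) / i! = ∑ₖ (k choose i) hₖ` of an `R`-module `M` of
dimension `d`. For `i ≤ d` these are the integers with
`λ_R(M / 𝔞ⁿ⁺¹ M) = ∑_{i ≤ d} (-1)ⁱ e_i ((n + d - i) choose (d - i))` for all large `n`. -/
noncomputable def hilbertCoeff {R : Type*} [CommRing R] (𝔞 : Ideal R)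
    (M : Type*) [AddCommGroup M] [Module R M] (d i : ℕ) : ℤ :=
  ∑ᶠ k : ℕ, (k.choose i : ℤ) * PowerSeries.coeff k (hSeries 𝔞 M d)

/-- The length over `A` of `J / IB`, where `I` is an ideal of `A` and `J` an ideal of `B`
containing `IB`. -/
noncomputable def relLength {A B : Type*} [CommRing A] [CommRing B] [Algebra A B]
    (I : Ideal A) (J : Ideal B) : ℕ :=
  (Module.length A (J ⧸ Submodule.submoduleOf (I.map (algebraMap A B)) J)).toNat

end RelHilbert

/-! ### Regular sequences modulo an ideal -/

namespace RelHilbert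

section GradeOnIdeals

variable {R : Type*} [CommRing R]

/-! Put K = IB. A-lengths of B-modules are δ times their B-lengths, so dividing by δ reduces the
theorem to the single ring B: with K a reduction of J and Gr_K Cohen–Macaulay, e₁(J) − e₁(K) ≥
λ(J/K), and equality makes Gr_J Cohen–Macaulay. Passing to B(T) gives an infinite residue field
without changing lengths or dimension.

A general choice (`exists_filSupSeq`) gives x₁, …, x_d in K whose initial forms are regular on Gr_K
and which are superficial for J. Let F_K, F_J be the generating functions of the lengths of B/(Kⁿ⁺¹
+ 𝔠), B/(Jⁿ⁺¹ + 𝔠). Killing xᵢ multiplies F_K by 1 − z exactly; for F_J there is an error polynomial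
with nonnegative coefficients, zero exactly when xᵢ has regular initial form
(`exists_lengthSeries_sub`). Hence h_J = h_K − (1 − z)g with g = (1 − z)^d (F_K − F_J), and e₁(J) −
e₁(K) = g(1). At z = 1 only the error of the last element survives, next to a sum of nonnegative
length differences in B/(x₁, …, x_d) whose degree zero term is λ(J/K). This is the inequality
(`exists_polynomial_comparison`). Equality kills the last error, and Sally's descent
(`FilSupSeq.sally`) carries regularity back to x₁.

It remains to pass from a regular sequence of initial forms ξᵢ on Gr_J to all maximal ideals,
including the nonhomogeneous ones. Modulo a maximal ideal P each ξᵢ satisfies a monic pᵢ over the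
enlarged base, and pᵢ(ξᵢ) has leading form a power of ξᵢ. A leading form argument makes the pᵢ(ξᵢ) a
regular sequence in the extension of P, and grade descends along the flat extension. Primes
containing all pᵢ(ξᵢ) are maximal by integrality, so P has height at most d in Gr_J
(`isCohenMacaulayRing_associatedGraded`). -/

/-- `x` is a nonzerodivisor on `R ⧸ Q`. -/
def IsRegMod (Q : Ideal R) (x : R) : Prop := ∀ y, x * y ∈ Q → y ∈ Q

/-- `l` is a weakly regular sequence on `R ⧸ Q`. -/
def RegSeqMod : Ideal R → List R → Prop
  | _, [] => True
  | Q, x :: l => IsRegMod Q x ∧ RegSeqMod (Q ⊔ Ideal.span {x}) l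

/-- `𝔞` contains a weakly regular sequence of length `d` on `R ⧸ Q`. -/
def GradeGE (𝔞 Q : Ideal R) (d : ℕ) : Prop :=
  ∃ l : List R, l.length = d ∧ (∀ x ∈ l, x ∈ 𝔞) ∧ RegSeqMod Q l

theorem gradeGE_zero (𝔞 Q : Ideal R) : GradeGE 𝔞 Q 0 := ⟨[], rfl, by simp, trivial⟩

theorem gradeGE_succ {𝔞 Q : Ideal R} {d : ℕ} :
    GradeGE 𝔞 Q (d + 1) ↔ ∃ x ∈ 𝔞, IsRegMod Q x ∧ GradeGE 𝔞 (Q ⊔ Ideal.span {x}) d := by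
  constructor
  · rintro ⟨l, hl, hm, hr⟩
    cases l with
    | nil => simp at hl
    | cons x l =>
      exact ⟨x, hm x (by simp), hr.1, l, by simpa using hl, fun y hy => hm y (by simp [hy]), hr.2⟩
  · rintro ⟨x, hx, hr, l, hl, hm, hl'⟩
    refine ⟨x :: l, by simp [hl], ?_, hr, hl'⟩
    intro y hy
    rcases List.mem_cons.1 hy with rfl | h
    · exact hx
    · exact hm _ h

theorem IsRegMod.pow {Q : Ideal R} {x : R} (h : IsRegMod Q x) (n : ℕ) : IsRegMod Q (x ^ n) := by
  induction n with
  | zero => intro y hy; simpa using hy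
  | succ n ih =>
    intro y hy
    exact ih y (h _ (by rwa [← mul_assoc, ← pow_succ']))

theorem mem_sup_span_singleton {Q : Ideal R} {x y : R} :
    y ∈ Q ⊔ Ideal.span {x} ↔ ∃ q ∈ Q, ∃ h, y = q + x * h := by
  rw [Submodule.mem_sup]
  constructor
  · rintro ⟨q, hq, z, hz, rfl⟩
    obtain ⟨h, rfl⟩ := Ideal.mem_span_singleton'.1 hz
    exact ⟨q, hq, h, by ring⟩
  · rintro ⟨q, hq, h, rfl⟩
    exact ⟨q, hq, x * h, Ideal.mem_span_singleton'.2 ⟨h, mul_comm _ _⟩, rfl⟩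

/-- The half of permutability of regular sequences that needs no locality: if xm = q + ym', then m'
is divisible by x modulo Q, and x cancels. -/
theorem IsRegMod.swap {Q : Ideal R} {x y : R} (hx : IsRegMod Q x)
    (hy : IsRegMod (Q ⊔ Ideal.span {x}) y) : IsRegMod (Q ⊔ Ideal.span {y}) x := by
  intro m hm
  obtain ⟨q, hq, m', h⟩ := mem_sup_span_singleton.1 hm
  have : y * m' ∈ Q ⊔ Ideal.span {x} :=
    mem_sup_span_singleton.2 ⟨-q, Q.neg_mem hq, m, by rw [h]; ring⟩
  obtain ⟨q', hq', m'', h'⟩ := mem_sup_span_singleton.1 (hy _ this)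
  have h2 : x * (m - y * m'') ∈ Q := by
    have : x * (m - y * m'') = q + y * q' := by rw [mul_sub, h, h']; ring
    rw [this]
    exact Q.add_mem hq (Q.mul_mem_left _ hq')
  exact mem_sup_span_singleton.2 ⟨_, hx _ h2, m'', by ring⟩

theorem IsRegMod.sup_pow {Q : Ideal R} {x y : R} (hx : IsRegMod Q x)
    (hy : IsRegMod (Q ⊔ Ideal.span {x}) y) (e : ℕ) : IsRegMod (Q ⊔ Ideal.span {x ^ e}) y := by
  induction e with
  | zero => intro m _; simp
  | succ e ih =>
    intro m hm
    obtain ⟨q, hq, h, h1⟩ := mem_sup_span_singleton.1 hm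
    have : y * m ∈ Q ⊔ Ideal.span {x} :=
      mem_sup_span_singleton.2 ⟨q, hq, x ^ e * h, by rw [h1]; ring⟩
    obtain ⟨q', hq', m', h2⟩ := mem_sup_span_singleton.1 (hy _ this)
    have h3 : x * (y * m' - x ^ e * h) ∈ Q := by
      have : x * (y * m' - x ^ e * h) = q - y * q' := by
        have : y * (q' + x * m') = q + x ^ (e + 1) * h := by rw [← h2, h1]
        linear_combination this
      rw [this]
      exact Q.sub_mem hq (Q.mul_mem_left _ hq')
    have h4 : y * m' ∈ Q ⊔ Ideal.span {x ^ e} :=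
      mem_sup_span_singleton.2 ⟨_, hx _ h3, h, by ring⟩
    obtain ⟨q'', hq'', m'', h5⟩ := mem_sup_span_singleton.1 (ih _ h4)
    exact mem_sup_span_singleton.2 ⟨q' + x * q'', Q.add_mem hq' (Q.mul_mem_left _ hq''), m'',
      by rw [h2, h5]; ring⟩

/-- Leading forms that are powers of given elements occur later. The induction moves the other
elements in front of x by `IsRegMod.swap`. -/
theorem RegSeqMod.sup_pow {Q : Ideal R} {x : R} (hx : IsRegMod Q x) {l : List R}
    (hl : RegSeqMod (Q ⊔ Ideal.span {x}) l) (e : ℕ) : RegSeqMod (Q ⊔ Ideal.span {x ^ e}) l := by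
  induction l generalizing Q with
  | nil => trivial
  | cons y l ih =>
    refine ⟨hx.sup_pow hl.1 e, ?_⟩
    rw [sup_right_comm]
    refine ih (hx.swap hl.1) ?_
    rw [sup_right_comm]
    exact hl.2

/-- Common avoidance for a finite family of ideals: if no element outside `Q j`
is multiplied into `Q j` by `𝔞`, then `𝔞` contains an element regular modulo every `Q j`. -/
theorem exists_isRegMod_of_forall [IsNoetherianRing R] {ι : Type*} [Finite ι] (𝔞 : Ideal R)
    (Q : ι → Ideal R) (h : ∀ j g, (∀ a ∈ 𝔞, a * g ∈ Q j) → g ∈ Q j) :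
    ∃ z ∈ 𝔞, ∀ j, IsRegMod (Q j) z := by
  have hfin : (⋃ j, associatedPrimes R (R ⧸ Q j)).Finite :=
    Set.finite_iUnion fun j => associatedPrimes.finite R (R ⧸ Q j)
  -- By prime avoidance, 𝔞 inside the union would lie in one associated prime (Q j : g) with g ∉ Q
  -- j, against `h`.
  have key : ¬ ((𝔞 : Set R) ⊆ ⋃ p ∈ ⋃ j, associatedPrimes R (R ⧸ Q j), ((id p : Ideal R) : Set R)) := by
    rw [Ideal.subset_union_prime_finite hfin ⊥ ⊥]
    · rintro ⟨p, hp, hle⟩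
      obtain ⟨j, hj⟩ := Set.mem_iUnion.1 hp
      obtain ⟨hpr, x, hx⟩ := (isAssociatedPrime_iff).1 hj
      obtain ⟨g, rfl⟩ := Ideal.Quotient.mk_surjective x
      have hg : g ∈ Q j := by
        refine h j g fun a ha => ?_
        have : a ∈ p := hle ha
        rw [hx, Submodule.mem_colon_singleton, Submodule.mem_bot] at this
        rw [← Ideal.Quotient.eq_zero_iff_mem, map_mul]
        exact this
      apply hpr.ne_top
      rw [hx, Ideal.Quotient.eq_zero_iff_mem.2 hg]
      simp
    · intro p hp _ _
      obtain ⟨j, hj⟩ := Set.mem_iUnion.1 hp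
      exact hj.isPrime
  obtain ⟨z, hz, hz'⟩ := Set.not_subset.1 key
  refine ⟨z, hz, fun j y hy => ?_⟩
  by_contra hyQ
  apply hz'
  have : z ∈ ⋃ p ∈ associatedPrimes R (R ⧸ Q j), (p : Set R) := by
    rw [biUnion_associatedPrimes_eq_zero_divisors]
    refine ⟨Ideal.Quotient.mk _ y, by rwa [Ne, Ideal.Quotient.eq_zero_iff_mem], ?_⟩
    rw [← Ideal.Quotient.eq_zero_iff_mem, map_mul] at hy
    exact hy
  simp only [Set.mem_iUnion] at this ⊢
  obtain ⟨p, hp, hzp⟩ := this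
  exact ⟨p, ⟨j, hp⟩, hzp⟩

theorem GradeGE.mem_of_forall {𝔞 Q : Ideal R} {d : ℕ} (h : GradeGE 𝔞 Q (d + 1)) {g : R}
    (hg : ∀ a ∈ 𝔞, a * g ∈ Q) : g ∈ Q := by
  obtain ⟨x, hx, hr, -⟩ := gradeGE_succ.1 h
  exact hr _ (hg x hx)

/-- The length of a maximal regular sequence does not depend on its first element. -/
theorem GradeGE.exchange [IsNoetherianRing R] {𝔞 : Ideal R} {d : ℕ} :
    ∀ {Q : Ideal R} {x : R}, GradeGE 𝔞 Q (d + 1) → x ∈ 𝔞 → IsRegMod Q x →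
      GradeGE 𝔞 (Q ⊔ Ideal.span {x}) d := by
  induction d with
  | zero => intro Q x _ _ _; exact gradeGE_zero _ _
  | succ d ih =>
    intro Q x hQ hx hxr
    obtain ⟨y, hy, hyr, hyd⟩ := gradeGE_succ.1 hQ
    -- If yg = q + xh, cancelling x gives ah ∈ Q + (y) for all a ∈ 𝔞, so h ∈ Q + (y) by the grade
    -- left modulo y; cancelling y gives g ∈ Q + (x).
    have h1 : ∀ g, (∀ a ∈ 𝔞, a * g ∈ Q ⊔ Ideal.span {x}) → g ∈ Q ⊔ Ideal.span {x} := by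
      intro g hg
      obtain ⟨q, hq, h, h1⟩ := mem_sup_span_singleton.1 (hg y hy)
      have h2 : h ∈ Q ⊔ Ideal.span {y} := by
        refine hyd.mem_of_forall fun a ha => ?_
        obtain ⟨q', hq', h', h3⟩ := mem_sup_span_singleton.1 (hg a ha)
        have : x * (a * h - y * h') ∈ Q := by
          have : x * (a * h - y * h') = y * q' - a * q := by
            linear_combination y * h3 - a * h1
          rw [this]
          exact Q.sub_mem (Q.mul_mem_left _ hq') (Q.mul_mem_left _ hq)
        exact mem_sup_span_singleton.2 ⟨_, hxr _ this, h', by ring⟩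
      obtain ⟨q'', hq'', h'', h4⟩ := mem_sup_span_singleton.1 h2
      have : y * (g - x * h'') ∈ Q := by
        have : y * (g - x * h'') = q + x * q'' := by
          rw [mul_sub, h1, h4]; ring
        rw [this]
        exact Q.add_mem hq (Q.mul_mem_left _ hq'')
      exact mem_sup_span_singleton.2 ⟨_, hyr _ this, h'', by ring⟩
    -- A common z links x to y: induction applied modulo y to z yields grade d + 1 modulo z, and is
    -- then applied modulo z to x.
    obtain ⟨z, hz, hzr⟩ := exists_isRegMod_of_forall 𝔞
      ![Q, Q ⊔ Ideal.span {x}, Q ⊔ Ideal.span {y}] (by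
        intro j
        fin_cases j
        · exact fun g hg => hQ.mem_of_forall hg
        · exact h1
        · exact fun g hg => hyd.mem_of_forall hg)
    have hz0 : IsRegMod Q z := hzr 0
    have hz1 : IsRegMod (Q ⊔ Ideal.span {x}) z := hzr 1
    have hz2 : IsRegMod (Q ⊔ Ideal.span {y}) z := hzr 2
    have h3 : GradeGE 𝔞 (Q ⊔ Ideal.span {z}) (d + 1) := by
      refine gradeGE_succ.2 ⟨y, hy, hyr.swap hz2, ?_⟩
      rw [sup_right_comm]
      exact ih hyd hz hz2
    refine gradeGE_succ.2 ⟨z, hz, hz1, ?_⟩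
    rw [sup_right_comm]
    exact ih h3 hx (hxr.swap hz1)

theorem comap_sup_span_singleton {S : Type*} [CommRing S] {f : R →+* S}
    (hf : Function.Surjective f) (Q : Ideal S) (x : R) :
    (Q ⊔ Ideal.span {f x}).comap f = Q.comap f ⊔ Ideal.span {x} := by
  ext y
  rw [Ideal.mem_comap, mem_sup_span_singleton, mem_sup_span_singleton]
  constructor
  · rintro ⟨q, hq, h, hy⟩
    obtain ⟨h, rfl⟩ := hf h
    exact ⟨y - x * h, by simpa [hy] using hq, h, by ring⟩
  · rintro ⟨q, hq, h, rfl⟩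
    exact ⟨f q, hq, f h, by simp⟩

/-- Regular sequences pull back along surjections. -/
theorem RegSeqMod.of_map_surjective {S : Type*} [CommRing S] {f : R →+* S}
    (hf : Function.Surjective f) {Q : Ideal S} {l : List R} (h : RegSeqMod Q (l.map f)) :
    RegSeqMod (Q.comap f) l := by
  induction l generalizing Q with
  | nil => trivial
  | cons x l ih =>
    refine ⟨fun y hy => h.1 _ (by simpa using hy), ?_⟩
    rw [← comap_sup_span_singleton hf]
    exact ih h.2

theorem RegSeqMod.map_of_surjective {S : Type*} [CommRing S] {f : R →+* S}
    (hf : Function.Surjective f) {Q : Ideal S} {l : List R} (h : RegSeqMod (Q.comap f) l) :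
    RegSeqMod Q (l.map f) := by
  induction l generalizing Q with
  | nil => trivial
  | cons x l ih =>
    refine ⟨fun y hy => ?_, ih ?_⟩
    · obtain ⟨y, rfl⟩ := hf y
      exact h.1 y (by simpa using hy)
    · rw [comap_sup_span_singleton hf]
      exact h.2

theorem GradeGE.comap_of_surjective {S : Type*} [CommRing S] {f : R →+* S}
    (hf : Function.Surjective f) {𝔞 Q : Ideal S} {d : ℕ} (h : GradeGE 𝔞 Q d) :
    GradeGE (𝔞.comap f) (Q.comap f) d := by
  obtain ⟨l, hl, hm, hr⟩ := h
  obtain ⟨l, rfl⟩ := List.map_surjective_iff.2 hf l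
  exact ⟨l, by simpa using hl, fun x hx => hm _ (List.mem_map_of_mem hx),
    RegSeqMod.of_map_surjective hf hr⟩

theorem GradeGE.of_comap_of_surjective {S : Type*} [CommRing S] {f : R →+* S}
    (hf : Function.Surjective f) {𝔞 Q : Ideal S} {d : ℕ}
    (h : GradeGE (𝔞.comap f) (Q.comap f) d) : GradeGE 𝔞 Q d := by
  obtain ⟨l, hl, hm, hr⟩ := h
  refine ⟨l.map f, by simpa using hl, fun x hx => ?_, hr.map_of_surjective hf⟩
  obtain ⟨y, hy, rfl⟩ := List.mem_map.1 hx
  exact hm y hy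

/-! ### Ascent and descent of grade along flat extensions. -/

section Flat

variable {S : Type*} [CommRing S] [Algebra R S] [Module.Flat R S]

/-- Along a flat extension `S` of `R`, `(Q S : g) ⊆ P S` as soon as `(Q : g) ⊆ P`. -/
theorem mem_map_of_mul_mem_map_of_flat {Q P : Ideal R} {g : R} (hP : ∀ a, g * a ∈ Q → a ∈ P)
    {s : S} (hs : algebraMap R S g * s ∈ Q.map (algebraMap R S)) :
    s ∈ P.map (algebraMap R S) := by
  obtain ⟨n, c, q, hq⟩ := Submodule.mem_span_set'.1 hs
  choose r hrQ hr using fun i => (q i).2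
  -- The equational criterion for flatness, applied to gs − Σ rᵢcᵢ = 0 with `none` indexing gs,
  -- writes s as a combination of elements a of R with ga ∈ Q.
  obtain ⟨k, a, y, h1, h2⟩ := Module.Flat.isTrivialRelation_of_sum_smul_eq_zero (R := R) (M := S)
      (ι := Option (Fin n)) (f := fun i => Option.elim i g (fun i => - r i))
      (x := fun i => Option.elim i s c) (by
    rw [Fintype.sum_option]
    simp only [Option.elim, Algebra.smul_def, map_neg, neg_mul, Finset.sum_neg_distrib]
    rw [← hq]
    simp [← hr, mul_comm])
  have h3 := h1 none
  simp only [Option.elim] at h3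
  rw [h3]
  refine Ideal.sum_mem _ fun j _ => ?_
  rw [Algebra.smul_def]
  refine Ideal.mul_mem_right _ _ (Ideal.mem_map_of_mem _ (hP _ ?_))
  have h4 := h2 j
  rw [Fintype.sum_option] at h4
  simp only [Option.elim] at h4
  rw [eq_neg_of_add_eq_zero_left h4]
  refine Q.neg_mem (Ideal.sum_mem _ fun i _ => Q.mul_mem_right _ (Q.neg_mem (hrQ i)))

theorem IsRegMod.map_of_flat {Q : Ideal R} {x : R} (h : IsRegMod Q x) :
    IsRegMod (Q.map (algebraMap R S)) (algebraMap R S x) :=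
  fun _ hy => mem_map_of_mul_mem_map_of_flat h hy

theorem RegSeqMod.map_of_flat {Q : Ideal R} {l : List R} (h : RegSeqMod Q l) :
    RegSeqMod (Q.map (algebraMap R S)) (l.map (algebraMap R S)) := by
  induction l generalizing Q with
  | nil => trivial
  | cons x l ih =>
    refine ⟨h.1.map_of_flat, ?_⟩
    have := ih h.2
    rwa [Ideal.map_sup, Ideal.map_span, Set.image_singleton] at this

theorem GradeGE.map_of_flat {𝔞 Q : Ideal R} {d : ℕ} (h : GradeGE 𝔞 Q d) :
    GradeGE (𝔞.map (algebraMap R S)) (Q.map (algebraMap R S)) d := by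
  obtain ⟨l, hl, hm, hr⟩ := h
  refine ⟨l.map (algebraMap R S), by simpa using hl, fun x hx => ?_, hr.map_of_flat⟩
  obtain ⟨y, hy, rfl⟩ := List.mem_map.1 hx
  exact Ideal.mem_map_of_mem _ (hm y hy)

/-- Descent of grade at a maximal ideal along a flat extension. -/
theorem GradeGE.of_map_of_flat [IsNoetherianRing R] [IsNoetherianRing S] {M : Ideal R}
    [hM : M.IsMaximal] (hMS : M.map (algebraMap R S) ≠ ⊤) {d : ℕ} {Q : Ideal R}
    (h : GradeGE (M.map (algebraMap R S)) (Q.map (algebraMap R S)) d) : GradeGE M Q d := by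
  induction d generalizing Q with
  | zero => exact gradeGE_zero _ _
  | succ d ih =>
    -- The given sequence lives in S, but a regular element is needed in M. If there were none, M =
    -- (Q : g) with g ∉ Q; positive grade over S puts g in QS, and flatness then puts 1 in MS.
    obtain ⟨x, hx, hxr⟩ := exists_isRegMod_of_forall M (fun _ : Unit => Q) (by
      intro _ g hg
      by_contra hgQ
      have hle : M ≤ Q.colon {g} := fun a ha => by
        rw [Submodule.mem_colon_singleton]
        exact hg a ha
      have hne : Q.colon {g} ≠ ⊤ := fun h => hgQ (by
        have : (1 : R) ∈ Q.colon {g} := h ▸ Submodule.mem_top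
        rw [Submodule.mem_colon_singleton] at this
        simpa using this)
      have heq := hM.eq_of_le hne hle
      have hgS : algebraMap R S g ∈ Q.map (algebraMap R S) := by
        refine h.mem_of_forall fun b hb => ?_
        refine Submodule.span_induction (p := fun b _ => b * algebraMap R S g ∈
          Q.map (algebraMap R S)) ?_ ?_ ?_ ?_ hb
        · rintro _ ⟨a, ha, rfl⟩
          rw [← map_mul]
          exact Ideal.mem_map_of_mem _ (hg a ha)
        · simp
        · intro a b _ _ ha hb
          rw [add_mul]
          exact Ideal.add_mem _ ha hb
        · intro a b _ hb
          rw [smul_eq_mul, mul_assoc]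
          exact Ideal.mul_mem_left _ _ hb
      apply hMS
      rw [Ideal.eq_top_iff_one]
      refine mem_map_of_mul_mem_map_of_flat (Q := Q) (g := g) (fun a ha => ?_) (by simpa using hgS)
      rw [heq, Submodule.mem_colon_singleton, smul_eq_mul, mul_comm]
      exact ha)
    have hxr : IsRegMod Q x := hxr ()
    refine gradeGE_succ.2 ⟨x, hx, hxr, ih ?_⟩
    have := h.exchange (Ideal.mem_map_of_mem _ hx) hxr.map_of_flat
    rwa [Ideal.map_sup, Ideal.map_span, Set.image_singleton]

end Flat

open scoped Pointwise in
/-- A weakly regular sequence on `R ⧸ Q`, in terms of Mathlib's notion. -/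
theorem isWeaklyRegular_iff_regSeqMod (l : List R) :
    RingTheory.Sequence.IsWeaklyRegular R l ↔ RegSeqMod ⊥ l := by
  have key : ∀ (l : List R) (Q : Ideal R),
      RingTheory.Sequence.IsWeaklyRegular (R ⧸ Q) l ↔ RegSeqMod Q l := by
    intro l
    induction l with
    | nil => intro Q; simp [RegSeqMod]
    | cons x l ih =>
      intro Q
      rw [RingTheory.Sequence.isWeaklyRegular_cons_iff, RegSeqMod, ← ih]
      refine and_congr ?_ ?_
      · rw [isSMulRegular_iff_right_eq_zero_of_smul]
        constructor
        · intro h y hy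
          rw [← Ideal.Quotient.eq_zero_iff_mem] at hy ⊢
          exact h _ hy
        · intro h y hy
          obtain ⟨y, rfl⟩ := Ideal.Quotient.mk_surjective y
          rw [Ideal.Quotient.eq_zero_iff_mem]
          apply h
          rw [← Ideal.Quotient.eq_zero_iff_mem]
          exact hy
      · refine LinearEquiv.isWeaklyRegular_congr ?_ l
        have h1 : Submodule.map (Ideal.Quotient.mkₐ R Q).toLinearMap (Ideal.span {x}) =
            x • (⊤ : Submodule R (R ⧸ Q)) := by
          ext z
          rw [Submodule.mem_map, Submodule.mem_smul_pointwise_iff_exists]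
          constructor
          · rintro ⟨y, hy, rfl⟩
            obtain ⟨b, rfl⟩ := Ideal.mem_span_singleton'.1 hy
            exact ⟨Ideal.Quotient.mk Q b, trivial, by
              rw [mul_comm]; rfl⟩
          · rintro ⟨b, -, rfl⟩
            obtain ⟨b, rfl⟩ := Ideal.Quotient.mk_surjective b
            exact ⟨x * b, Ideal.mul_mem_right _ _ (Ideal.mem_span_singleton_self x), rfl⟩
        exact (Submodule.quotEquivOfEq _ _ h1.symm).trans
          (Submodule.quotientQuotientEquivQuotientSup Q (Ideal.span {x}))
  rw [← key]
  exact LinearEquiv.isWeaklyRegular_congr (Submodule.quotEquivOfEqBot ⊥ rfl).symm l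

end GradeOnIdeals

end RelHilbert

/-! ### Homogeneous ideals of Rees algebras -/

namespace RelHilbert

open Polynomial TensorProduct

section Rees

variable {B : Type*} [CommRing B]

/-- The element `b Xⁿ` of the Rees algebra of `K`, for `b ∈ Kⁿ`. -/
noncomputable def reesMonomial (K : Ideal B) (n : ℕ) (b : B) (hb : b ∈ K ^ n) : reesAlgebra K :=
  ⟨monomial n b, reesAlgebra.monomial_mem.2 hb⟩

@[simp] theorem reesMonomial_val (K : Ideal B) (n : ℕ) (b : B) (hb : b ∈ K ^ n) :
    (reesMonomial K n b hb : B[X]) = monomial n b := rfl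

theorem reesMonomial_zero (K : Ideal B) (n : ℕ) (h : (0 : B) ∈ K ^ n) : reesMonomial K n 0 h = 0 :=
  Subtype.ext (by simp)

theorem reesMonomial_add (K : Ideal B) (n : ℕ) {a b : B} (ha : a ∈ K ^ n) (hb : b ∈ K ^ n)
    (h : a + b ∈ K ^ n) :
    reesMonomial K n (a + b) h = reesMonomial K n a ha + reesMonomial K n b hb :=
  Subtype.ext (by simp)

theorem reesMonomial_algebraMap_mul (K : Ideal B) (n : ℕ) (a : B) {b : B} (hb : b ∈ K ^ n)
    (h : a * b ∈ K ^ n) :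
    reesMonomial K n (a * b) h = algebraMap B (reesAlgebra K) a * reesMonomial K n b hb :=
  Subtype.ext (C_mul_monomial (a := a) (b := b) (n := n)).symm

theorem reesMonomial_mul (K : Ideal B) {m n : ℕ} {a b : B} (ha : a ∈ K ^ m) (hb : b ∈ K ^ n) :
    reesMonomial K m a ha * reesMonomial K n b hb =
      reesMonomial K (m + n) (a * b) (by rw [pow_add]; exact Ideal.mul_mem_mul ha hb) :=
  Subtype.ext (by simp [monomial_mul_monomial])

theorem sum_reesMonomial {K : Ideal B} (f : reesAlgebra K) :
    f = ∑ n ∈ (f : B[X]).support, reesMonomial K n ((f : B[X]).coeff n) (f.2 n) := by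
  apply Subtype.ext
  rw [AddSubmonoidClass.coe_finsetSum]
  exact (f : B[X]).as_sum_support

/-- Stated for additively closed subsets so that it also serves ranges of algebra maps and preimages
of submodules. -/
theorem mem_of_forall_reesMonomial {K : Ideal B} {S : Type*} [SetLike S (reesAlgebra K)]
    [AddSubmonoidClass S (reesAlgebra K)] (𝔮 : S) (f : reesAlgebra K)
    (h : ∀ n, reesMonomial K n ((f : B[X]).coeff n) (f.2 n) ∈ 𝔮) : f ∈ 𝔮 := by
  rw [sum_reesMonomial f]
  exact sum_mem fun n _ => h n

/-- The homogeneous ideal of the Rees algebra of `K` whose elements have `n`-th coefficient in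
`Kⁿ⁺¹ + 𝔠`. The quotient is `⨁ₙ Kⁿ / (Kⁿ ∩ (Kⁿ⁺¹ + 𝔠))`. -/
def reesQuot (K 𝔠 : Ideal B) : Ideal (reesAlgebra K) where
  carrier := {f | ∀ n, (f : B[X]).coeff n ∈ K ^ (n + 1) ⊔ 𝔠}
  add_mem' hf hg n := by
    simpa using Ideal.add_mem _ (hf n) (hg n)
  zero_mem' n := by simp
  smul_mem' f g hg n := by
    rw [smul_eq_mul, MulMemClass.coe_mul, coeff_mul]
    refine Ideal.sum_mem _ ?_
    rintro ⟨i, j⟩ hij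
    obtain ⟨k, hk, c, hc, h⟩ := Submodule.mem_sup.1 (hg j)
    rw [← h, mul_add]
    refine Ideal.add_mem _ (Ideal.mem_sup_left ?_) (Ideal.mem_sup_right (𝔠.mul_mem_left _ hc))
    have := Ideal.mul_mem_mul (f.2 i) hk
    rw [← pow_add] at this
    have hij : i + j = n := by simpa using hij
    rwa [← hij, add_assoc]

theorem mem_reesQuot {K 𝔠 : Ideal B} {f : reesAlgebra K} :
    f ∈ reesQuot K 𝔠 ↔ ∀ n, (f : B[X]).coeff n ∈ K ^ (n + 1) ⊔ 𝔠 := Iff.rfl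

theorem reesMonomial_mem_reesQuot {K 𝔠 : Ideal B} {n : ℕ} {b : B} {hb : b ∈ K ^ n} :
    reesMonomial K n b hb ∈ reesQuot K 𝔠 ↔ b ∈ K ^ (n + 1) ⊔ 𝔠 := by
  rw [mem_reesQuot]
  constructor
  · intro h; simpa using h n
  · intro h m
    rw [reesMonomial_val, coeff_monomial]
    split_ifs with hm
    · rwa [← hm]
    · exact zero_mem _

/-- The link with `AssociatedGraded`: Gr_K is studied through homogeneous ideals of the Rees algebra
rather than through a grading on the quotient. -/
theorem reesQuot_bot (K : Ideal B) :
    reesQuot K ⊥ = K.map (algebraMap B (reesAlgebra K)) := by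
  apply le_antisymm
  · intro f hf
    refine mem_of_forall_reesMonomial _ f fun n => ?_
    have hn := hf n
    rw [sup_bot_eq, pow_succ'] at hn
    have key : ∀ b (hb : b ∈ K * K ^ n), ∀ hb' : b ∈ K ^ n,
        reesMonomial K n b hb' ∈ K.map (algebraMap B (reesAlgebra K)) := by
      intro b hb
      refine Submodule.mul_induction_on' (C := fun b _ => ∀ hb' : b ∈ K ^ n,
        reesMonomial K n b hb' ∈ K.map (algebraMap B (reesAlgebra K))) ?_ ?_ hb
      · intro a ha c hc hb'
        rw [reesMonomial_algebraMap_mul K n a hc]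
        exact Ideal.mul_mem_right _ _ (Ideal.mem_map_of_mem _ ha)
      · intro a ha c hc h1 h2 hb'
        rw [reesMonomial_add K n (Ideal.mul_le_right (I := K) ha) (Ideal.mul_le_right (I := K) hc)]
        exact Ideal.add_mem _ (h1 _) (h2 _)
    exact key _ hn _
  · rw [Ideal.map_le_iff_le_comap]
    intro a ha
    have : algebraMap B (reesAlgebra K) a = reesMonomial K 0 a (by simp) := Subtype.ext (by simp)
    rw [Ideal.mem_comap, this, reesMonomial_mem_reesQuot]
    exact Ideal.mem_sup_left (by simpa using ha)

theorem isRegMod_reesQuot_iff {K 𝔠 : Ideal B} {x : B} (hx : x ∈ K ^ 1) :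
    IsRegMod (reesQuot K 𝔠) (reesMonomial K 1 x hx) ↔
      ∀ n b, b ∈ K ^ n → x * b ∈ K ^ (n + 2) ⊔ 𝔠 → b ∈ K ^ (n + 1) ⊔ 𝔠 := by
  constructor
  · intro h n b hb hxb
    rw [← reesMonomial_mem_reesQuot (hb := hb)]
    apply h
    rw [reesMonomial_mul, reesMonomial_mem_reesQuot]
    convert hxb using 3
    omega
  · intro h f hf n
    refine h n _ (f.2 n) ?_
    have := hf (n + 1)
    rwa [MulMemClass.coe_mul, reesMonomial_val, ← C_mul_X_eq_monomial, add_comm n 1, 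
      mul_assoc, coeff_C_mul, add_comm 1 n, coeff_X_mul] at this

/-- Regularity of the initial form of `x` in degree one amounts to
`(Kⁿ⁺¹ + 𝔠 : x) = Kⁿ + 𝔠` for all `n`. -/
theorem mem_of_mul_mem_of_isRegMod {K 𝔠 : Ideal B} {x : B} {hx : x ∈ K ^ 1}
    (h : IsRegMod (reesQuot K 𝔠) (reesMonomial K 1 x hx)) (n : ℕ) (b : B)
    (hb : x * b ∈ K ^ (n + 1) ⊔ 𝔠) : b ∈ K ^ n ⊔ 𝔠 := by
  rw [isRegMod_reesQuot_iff] at h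
  -- The order of b is raised one degree at a time, the 𝔠-part being discarded at each stage.
  have key : ∀ m ≤ n, b ∈ K ^ m ⊔ 𝔠 := by
    intro m
    induction m with
    | zero => intro _; simp
    | succ m ih =>
      intro hm
      obtain ⟨k, hk, c, hc, rfl⟩ := Submodule.mem_sup.1 (ih (by omega))
      refine Ideal.add_mem _ (h m k hk ?_) (Ideal.mem_sup_right hc)
      have hle : K ^ (n + 1) ⊔ 𝔠 ≤ K ^ (m + 2) ⊔ 𝔠 :=
        sup_le_sup_right (Ideal.pow_le_pow_right (by omega)) _
      have h1 : x * (k + c) ∈ K ^ (m + 2) ⊔ 𝔠 := hle hb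
      have h2 : x * k = x * (k + c) - x * c := by ring
      rw [h2]
      exact Ideal.sub_mem _ h1 (Ideal.mem_sup_right (𝔠.mul_mem_left _ hc))
  exact key n le_rfl

theorem isRegMod_reesQuot_of_forall {K 𝔠 : Ideal B} {x : B} (hx : x ∈ K ^ 1)
    (h : ∀ n b, x * b ∈ K ^ (n + 1) ⊔ 𝔠 → b ∈ K ^ n ⊔ 𝔠) :
    IsRegMod (reesQuot K 𝔠) (reesMonomial K 1 x hx) :=
  (isRegMod_reesQuot_iff hx).2 fun n b _ hb => h (n + 1) b hb

theorem reesQuot_mono {K 𝔠 𝔡 : Ideal B} (h : 𝔠 ≤ 𝔡) : reesQuot K 𝔠 ≤ reesQuot K 𝔡 :=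
  fun _ hf n => sup_le_sup_left h _ (hf n)

/-- Forming the graded ring commutes with killing x once its initial form is regular: if b = q + xy
has order n + 1 and q has order n + 2 modulo 𝔠, the colon condition gives y order n modulo 𝔠. -/
theorem reesQuot_sup_span {K 𝔠 : Ideal B} {x : B} (hx : x ∈ K ^ 1)
    (h : ∀ n b, x * b ∈ K ^ (n + 1) ⊔ 𝔠 → b ∈ K ^ n ⊔ 𝔠) :
    reesQuot K 𝔠 ⊔ Ideal.span {reesMonomial K 1 x hx} = reesQuot K (𝔠 ⊔ Ideal.span {x}) := by
  apply le_antisymm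
  · refine sup_le (reesQuot_mono le_sup_left) ?_
    rw [Ideal.span_singleton_le_iff_mem, reesMonomial_mem_reesQuot]
    exact Ideal.mem_sup_right (Ideal.mem_sup_right (Ideal.mem_span_singleton_self x))
  · intro f hf
    refine mem_of_forall_reesMonomial _ f fun n => ?_
    have hfn := hf n
    have hfn' := f.2 n
    suffices ∀ b (hb : b ∈ K ^ n), b ∈ K ^ (n + 1) ⊔ (𝔠 ⊔ Ideal.span {x}) →
        reesMonomial K n b hb ∈ reesQuot K 𝔠 ⊔ Ideal.span {reesMonomial K 1 x hx} from
      this _ hfn' hfn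
    clear hfn hfn'
    intro b hfn' hfn
    rw [← sup_assoc] at hfn
    cases n with
    | zero =>
      refine Ideal.mem_sup_left (reesMonomial_mem_reesQuot.2 ?_)
      have : Ideal.span {x} ≤ K ^ (0 + 1) ⊔ 𝔠 := by
        rw [Ideal.span_singleton_le_iff_mem]
        exact Ideal.mem_sup_left hx
      rwa [sup_eq_left.2 this] at hfn
    | succ n =>
      obtain ⟨q, hq, y, hy⟩ := mem_sup_span_singleton.1 hfn
      have h1 : x * y ∈ K ^ (n + 1) ⊔ 𝔠 := by
        have : x * y = b - q := by rw [hy]; ring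
        have hle : K ^ (n + 1 + 1) ⊔ 𝔠 ≤ K ^ (n + 1) ⊔ 𝔠 :=
          sup_le_sup_right (Ideal.pow_le_pow_right (by omega)) _
        rw [this]
        exact Ideal.sub_mem _ (Ideal.mem_sup_left hfn') (hle hq)
      obtain ⟨k, hk, c, hc, hkc⟩ := Submodule.mem_sup.1 (h n y h1)
      have hxk : x * k ∈ K ^ (n + 1) := by
        rw [pow_succ']; exact Ideal.mul_mem_mul (by simpa using hx) hk
      have hbk : b - x * k ∈ K ^ (n + 1) := Ideal.sub_mem _ hfn' hxk
      refine mem_sup_span_singleton.2 ⟨reesMonomial K (n + 1) (b - x * k) hbk, ?_,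
        reesMonomial K n k hk, Subtype.ext ?_⟩
      · rw [reesMonomial_mem_reesQuot]
        have : b - x * k = q + x * c := by rw [hy, ← hkc]; ring
        rw [this]
        exact Ideal.add_mem _ hq (Ideal.mem_sup_right (𝔠.mul_mem_left _ hc))
      · rw [reesMonomial_mul]
        simp [add_comm 1 n]

/-- The ideal of the Rees algebra of elements whose constant coefficient is in `𝔫`. -/
noncomputable def reesMax (K 𝔫 : Ideal B) : Ideal (reesAlgebra K) :=
  𝔫.comap ((constantCoeff (R := B)).comp (reesAlgebra K).val.toRingHom)

theorem mem_reesMax {K 𝔫 : Ideal B} {f : reesAlgebra K} :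
    f ∈ reesMax K 𝔫 ↔ (f : B[X]).coeff 0 ∈ 𝔫 := Iff.rfl

theorem reesMax_isMaximal (K 𝔫 : Ideal B) [𝔫.IsMaximal] : (reesMax K 𝔫).IsMaximal := by
  refine Ideal.comap_isMaximal_of_surjective _ fun b => ⟨algebraMap B _ b, ?_⟩
  exact coeff_C_zero

theorem reesQuot_le_reesMax {K 𝔠 𝔫 : Ideal B} (hK : K ≤ 𝔫) (h𝔠 : 𝔠 ≤ 𝔫) :
    reesQuot K 𝔠 ≤ reesMax K 𝔫 := fun f hf => by
  have := hf 0
  rw [zero_add, pow_one] at this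
  exact sup_le hK h𝔠 this

theorem reesMonomial_mem_reesMax {K 𝔫 : Ideal B} {n : ℕ} (hn : n ≠ 0) {b : B} (hb : b ∈ K ^ n) :
    reesMonomial K n b hb ∈ reesMax K 𝔫 := by
  rw [mem_reesMax, reesMonomial_val, coeff_monomial, if_neg hn]
  exact zero_mem _

end Rees

/-! ### Rees algebras under base change. -/

section ReesBaseChange

variable {B : Type*} [CommRing B] (B' : Type*) [CommRing B'] [Algebra B B'] (K : Ideal B)

/-- The ring homomorphism between Rees algebras induced by `B → B'`. -/
noncomputable def reesMap : reesAlgebra K →+* reesAlgebra (K.map (algebraMap B B')) :=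
  ((mapRingHom (algebraMap B B')).comp (reesAlgebra K).val.toRingHom).codRestrict
    (reesAlgebra (K.map (algebraMap B B'))).toSubring fun f n => by
      have := Ideal.mem_map_of_mem (algebraMap B B') (f.2 n)
      rw [Ideal.map_pow] at this
      simpa using this

noncomputable instance reesMapAlgebra :
    Algebra (reesAlgebra K) (reesAlgebra (K.map (algebraMap B B'))) :=
  (reesMap B' K).toAlgebra

theorem algebraMap_rees_val (f : reesAlgebra K) :
    (algebraMap (reesAlgebra K) (reesAlgebra (K.map (algebraMap B B'))) f : B'[X]) =
      (f : B[X]).map (algebraMap B B') := rfl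

/-- Membership in the extension of an ideal to the Rees algebra over `B'`. -/
theorem mem_map_rees_of_coeff {K} (𝔮 : Ideal (reesAlgebra K)) (𝔟 : ℕ → Ideal B)
    (h : ∀ n b, b ∈ 𝔟 n → ∃ hb : b ∈ K ^ n, reesMonomial K n b hb ∈ 𝔮)
    (f : reesAlgebra (K.map (algebraMap B B')))
    (hf : ∀ n, (f : B'[X]).coeff n ∈ (𝔟 n).map (algebraMap B B')) :
    f ∈ 𝔮.map (algebraMap _ (reesAlgebra (K.map (algebraMap B B')))) := by
  refine mem_of_forall_reesMonomial _ f fun n => ?_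
  have key : ∀ c ∈ (𝔟 n).map (algebraMap B B'), ∃ hc : c ∈ (K.map (algebraMap B B')) ^ n,
      reesMonomial _ n c hc ∈ 𝔮.map (algebraMap _ (reesAlgebra (K.map (algebraMap B B')))) := by
    intro c hc
    refine Submodule.span_induction (p := fun c _ => ∃ hc : c ∈ (K.map (algebraMap B B')) ^ n,
      reesMonomial _ n c hc ∈ 𝔮.map (algebraMap _ (reesAlgebra (K.map (algebraMap B B')))))
      ?_ ?_ ?_ ?_ hc
    · rintro _ ⟨b, hb, rfl⟩
      obtain ⟨hb', hm⟩ := h n b hb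
      refine ⟨by rw [← Ideal.map_pow]; exact Ideal.mem_map_of_mem _ hb', ?_⟩
      convert Ideal.mem_map_of_mem (algebraMap _ (reesAlgebra (K.map (algebraMap B B')))) hm
      exact Subtype.ext (by rw [algebraMap_rees_val]; simp)
    · refine ⟨zero_mem _, ?_⟩
      rw [reesMonomial_zero]
      exact zero_mem _
    · rintro x y - - ⟨hx, hx'⟩ ⟨hy, hy'⟩
      refine ⟨add_mem hx hy, ?_⟩
      rw [reesMonomial_add _ _ hx hy]
      exact add_mem hx' hy'
    · rintro a x - ⟨hx, hx'⟩
      refine ⟨Ideal.mul_mem_left _ _ hx, ?_⟩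
      have := reesMonomial_algebraMap_mul _ _ a hx (Ideal.mul_mem_left _ _ hx)
      exact this ▸ Ideal.mul_mem_left _ _ hx'
  exact (key _ (hf n)).2

theorem reesMax_map (𝔫 : Ideal B) :
    (reesMax K 𝔫).map (algebraMap _ (reesAlgebra (K.map (algebraMap B B')))) =
      reesMax (K.map (algebraMap B B')) (𝔫.map (algebraMap B B')) := by
  apply le_antisymm
  · rw [Ideal.map_le_iff_le_comap]
    intro f hf
    rw [Ideal.mem_comap, mem_reesMax, algebraMap_rees_val, coeff_map]
    exact Ideal.mem_map_of_mem _ hf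
  · intro f hf
    refine mem_map_rees_of_coeff B' _ (fun n => if n = 0 then 𝔫 else K ^ n) ?_ f ?_
    · intro n b hb
      rcases eq_or_ne n 0 with rfl | hn
      · exact ⟨by simp, by simpa [mem_reesMax] using hb⟩
      · rw [if_neg hn] at hb
        exact ⟨hb, reesMonomial_mem_reesMax hn hb⟩
    · intro n
      rcases eq_or_ne n 0 with rfl | hn
      · simpa using mem_reesMax.1 hf
      · simpa [hn, Ideal.map_pow] using f.2 n

theorem reesQuot_bot_map :
    (reesQuot K ⊥).map (algebraMap _ (reesAlgebra (K.map (algebraMap B B')))) =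
      reesQuot (K.map (algebraMap B B')) ⊥ := by
  apply le_antisymm
  · rw [Ideal.map_le_iff_le_comap]
    intro f hf n
    rw [algebraMap_rees_val, coeff_map, sup_bot_eq, ← Ideal.map_pow]
    exact Ideal.mem_map_of_mem _ (by simpa using hf n)
  · intro f hf
    refine mem_map_rees_of_coeff B' _ (fun n => K ^ (n + 1)) ?_ f ?_
    · intro n b hb
      exact ⟨Ideal.pow_le_pow_right (by omega) hb,
        reesMonomial_mem_reesQuot.2 (Ideal.mem_sup_left hb)⟩
    · intro n
      simpa [Ideal.map_pow] using hf n

theorem isScalarTower_rees :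
    IsScalarTower B (reesAlgebra K) (reesAlgebra (K.map (algebraMap B B'))) := by
  refine IsScalarTower.of_algebraMap_eq fun b => Subtype.ext ?_
  rw [algebraMap_rees_val]
  change C (algebraMap B B' b) = Polynomial.map _ (C b)
  simp

/-- Surjectivity is checked on monomials. Injectivity uses flatness: the inclusion of the Rees
algebra in B[X] stays injective after tensoring with B'. -/
theorem exists_rees_baseChange [Module.Flat B B'] :
    ∃ e : reesAlgebra K ⊗[B] B' ≃ₐ[reesAlgebra K] reesAlgebra (K.map (algebraMap B B')),
      ∀ f b, e (f ⊗ₜ b) = algebraMap _ (reesAlgebra (K.map (algebraMap B B'))) f *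
        algebraMap B' (reesAlgebra (K.map (algebraMap B B'))) b := by
  have := isScalarTower_rees B' K
  let R' := reesAlgebra (K.map (algebraMap B B'))
  let ψ : reesAlgebra K ⊗[B] B' →ₐ[reesAlgebra K] R' :=
    Algebra.TensorProduct.lift (Algebra.ofId _ _) (IsScalarTower.toAlgHom B B' R')
      fun _ _ => Commute.all _ _
  have hψ : ∀ f b, ψ (f ⊗ₜ b) = algebraMap _ R' f * algebraMap B' R' b := fun f b => by
    simp [ψ, Algebra.ofId_apply]
  have hsurj : Function.Surjective ψ := by
    intro f
    change f ∈ ψ.range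
    refine mem_of_forall_reesMonomial _ f fun n => ?_
    have key : ∀ c ∈ (K ^ n).map (algebraMap B B'), ∃ hc : c ∈ (K.map (algebraMap B B')) ^ n,
        reesMonomial _ n c hc ∈ ψ.range := by
      intro c hc
      refine Submodule.span_induction (p := fun c _ => ∃ hc : c ∈ (K.map (algebraMap B B')) ^ n,
        reesMonomial _ n c hc ∈ ψ.range) ?_ ?_ ?_ ?_ hc
      · rintro _ ⟨b, hb, rfl⟩
        refine ⟨by rw [← Ideal.map_pow]; exact Ideal.mem_map_of_mem _ hb,
          reesMonomial K n b hb ⊗ₜ 1, ?_⟩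
        apply Subtype.ext
        change (ψ _ : B'[X]) = _
        rw [hψ, map_one, mul_one, algebraMap_rees_val]
        simp
      · refine ⟨zero_mem _, ?_⟩
        rw [reesMonomial_zero]
        exact zero_mem _
      · rintro x y - - ⟨hx, hx'⟩ ⟨hy, hy'⟩
        refine ⟨add_mem hx hy, ?_⟩
        rw [reesMonomial_add _ _ hx hy]
        exact add_mem hx' hy'
      · rintro a x - ⟨hx, hx'⟩
        refine ⟨Ideal.mul_mem_left _ _ hx, ?_⟩
        have ha : algebraMap B' R' a ∈ ψ.range := ⟨1 ⊗ₜ a, by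
          change ψ _ = _
          rw [hψ]; simp⟩
        have := reesMonomial_algebraMap_mul _ _ a hx (Ideal.mul_mem_left _ _ hx)
        exact this ▸ mul_mem ha hx'
    exact (key _ (by rw [Ideal.map_pow]; exact f.2 n)).2
  have hinj : Function.Injective ψ := by
    let θ : reesAlgebra K ⊗[B] B' →ₗ[B] B'[X] :=
      (polyEquivTensor B B').symm.toLinearMap ∘ₗ (TensorProduct.comm B B[X] B').toLinearMap ∘ₗ
        LinearMap.rTensor B' (reesAlgebra K).val.toLinearMap
    have hθ : Function.Injective θ := by
      refine (polyEquivTensor B B').symm.injective.comp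
        ((TensorProduct.comm B B[X] B').injective.comp ?_)
      exact Module.Flat.rTensor_preserves_injective_linearMap _ Subtype.val_injective
    have hcomp : ∀ t, (ψ t : B'[X]) = θ t := by
      intro t
      induction t with
      | zero => simp
      | add x y hx hy => rw [map_add, map_add, ← hx, ← hy]; rfl
      | tmul f b =>
        rw [hψ]
        change _ = (polyEquivTensor B B').symm (b ⊗ₜ (f : B[X]))
        rw [polyEquivTensor_symm_apply_tmul_eq_smul, MulMemClass.coe_mul, algebraMap_rees_val,
          mul_comm, smul_eq_C_mul]
        rfl
    intro s t hst
    apply hθ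
    rw [← hcomp, ← hcomp, hst]
  exact ⟨AlgEquiv.ofBijective ψ ⟨hinj, hsurj⟩, hψ⟩

theorem rees_flat [Module.Flat B B'] :
    Module.Flat (reesAlgebra K) (reesAlgebra (K.map (algebraMap B B'))) :=
  have ⟨e, _⟩ := exists_rees_baseChange B' K
  Module.Flat.of_linearEquiv e.symm.toLinearEquiv

theorem rees_faithfullyFlat [Module.FaithfullyFlat B B'] :
    Module.FaithfullyFlat (reesAlgebra K) (reesAlgebra (K.map (algebraMap B B'))) :=
  have ⟨e, _⟩ := exists_rees_baseChange B' K
  Module.FaithfullyFlat.of_linearEquiv (reesAlgebra K) (reesAlgebra K ⊗[B] B') e.symm.toLinearEquiv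

end ReesBaseChange

theorem flat_quotient_map {R S : Type*} [CommRing R] [CommRing S] [Algebra R S] [Module.Flat R S]
    (I : Ideal R) : Module.Flat (R ⧸ I) (S ⧸ I.map (algebraMap R S)) :=
  Module.Flat.of_linearEquiv (Algebra.TensorProduct.quotIdealMapEquivQuotTensor S I).toLinearEquiv

end RelHilbert

/-! ### Superficial elements -/

namespace RelHilbert

open Polynomial IsLocalRing

/-- A nonzero cyclic submodule maps onto the infinite residue field. -/
theorem not_finite_of_isLocalRing {R M : Type*} [CommRing R] [IsLocalRing R]
    [Infinite (ResidueField R)] [AddCommGroup M] [Module R M] [Nontrivial M] : ¬ Finite M := by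
  intro _
  obtain ⟨m, hm⟩ := exists_ne (0 : M)
  have hle : (LinearMap.toSpanSingleton R M m).ker ≤ maximalIdeal R := by
    refine IsLocalRing.le_maximalIdeal fun h => hm ?_
    have : (1 : R) ∈ (LinearMap.toSpanSingleton R M m).ker := h ▸ Submodule.mem_top
    simpa using this
  have h1 : Finite (R ⧸ (LinearMap.toSpanSingleton R M m).ker) :=
    Finite.of_injective _ (LinearMap.toSpanSingleton R M m).quotKerEquivRange.injective
  have h2 : Function.Surjective (Ideal.Quotient.factor hle) := Ideal.Quotient.factor_surjective hle
  have : Finite (ResidueField R) := Finite.of_surjective _ h2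
  exact not_finite (ResidueField R)

/-- Over a local ring with infinite residue field, no module is a finite union of proper
submodules. -/
theorem exists_forall_notMem_of_ne_top {R M ι : Type*} [CommRing R] [IsLocalRing R]
    [Infinite (ResidueField R)] [AddCommGroup M] [Module R M] {s : Set ι} (hs : s.Finite)
    (V : ι → Submodule R M) (hV : ∀ i ∈ s, V i ≠ ⊤) : ∃ x : M, ∀ i ∈ s, x ∉ V i := by
  classical
  by_contra! h
  have hcov : ⋃ p ∈ hs.toFinset.image V, (p : Set M) = Set.univ := by
    rw [Set.eq_univ_iff_forall]
    intro x
    obtain ⟨i, hi, hx⟩ := h x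
    simp only [Set.mem_iUnion]
    exact ⟨V i, Finset.mem_image_of_mem _ (hs.mem_toFinset.2 hi), hx⟩
  -- Neumann's lemma: a finite cover by subgroups contains one of finite index.
  obtain ⟨p, hp, hfin⟩ := Submodule.exists_finiteIndex_of_cover hcov
  obtain ⟨i, hi, rfl⟩ := Finset.mem_image.1 hp
  have : Finite (M ⧸ V i) := AddSubgroup.finite_quotient_of_finiteIndex
  have : Nontrivial (M ⧸ V i) := Submodule.Quotient.nontrivial_iff.2 (hV i (hs.mem_toFinset.1 hi))
  exact not_finite_of_isLocalRing (R := R) (M := M ⧸ V i) inferInstance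

section Assoc

variable {R : Type*} [CommRing R] {Q : Ideal R}

variable (Q) in
/-- The associated primes of `R ⧸ Q`. -/
def assPrimes : Set (Ideal R) := associatedPrimes R (R ⧸ Q)

theorem assPrimes_finite [IsNoetherianRing R] : (assPrimes Q).Finite := associatedPrimes.finite _ _

theorem exists_of_mem_assPrimes [IsNoetherianRing R] {p : Ideal R} (hp : p ∈ assPrimes Q) :
    p.IsPrime ∧ ∃ g ∉ Q, ∀ r, r ∈ p ↔ r * g ∈ Q := by
  obtain ⟨hpr, x, hx⟩ := isAssociatedPrime_iff.1 hp
  obtain ⟨g, rfl⟩ := Ideal.Quotient.mk_surjective x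
  have key : ∀ r, r ∈ p ↔ r * g ∈ Q := by
    intro r
    rw [hx, Submodule.mem_colon_singleton, Submodule.mem_bot, ← Ideal.Quotient.eq_zero_iff_mem,
      map_mul]
    rfl
  refine ⟨hpr, g, fun hg => hpr.ne_top ?_, key⟩
  rw [Ideal.eq_top_iff_one, key]
  simpa using hg

theorem isRegMod_of_forall_notMem [IsNoetherianRing R] {z : R}
    (h : ∀ p ∈ assPrimes Q, z ∉ p) : IsRegMod Q z := by
  intro y hy
  by_contra hyQ
  have : z ∈ ⋃ p ∈ associatedPrimes R (R ⧸ Q), (p : Set R) := by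
    rw [biUnion_associatedPrimes_eq_zero_divisors]
    refine ⟨Ideal.Quotient.mk _ y, by rwa [Ne, Ideal.Quotient.eq_zero_iff_mem], ?_⟩
    rw [← Ideal.Quotient.eq_zero_iff_mem, map_mul] at hy
    exact hy
  simp only [Set.mem_iUnion] at this
  obtain ⟨p, hp, hzp⟩ := this
  exact h p hp hzp

end Assoc

section Superficial

variable {B : Type*} [CommRing B]

/-- Used with L a reduction of J, where LJⁿ is all of Jⁿ⁺¹ for suitable n. -/
theorem reesMonomial_succ_mem {J L : Ideal B} (hL : L ≤ J) {n : ℕ} (𝔮 : Ideal (reesAlgebra J))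
    (h : ∀ a (ha : a ∈ L) b (hb : b ∈ J ^ n),
      reesMonomial J 1 a (by simpa using hL ha) * reesMonomial J n b hb ∈ 𝔮) (b : B)
    (hb : b ∈ L * J ^ n) (hb' : b ∈ J ^ (n + 1)) : reesMonomial J (n + 1) b hb' ∈ 𝔮 := by
  refine Submodule.mul_induction_on' (C := fun b _ => ∀ hb' : b ∈ J ^ (n + 1),
    reesMonomial J (n + 1) b hb' ∈ 𝔮) ?_ ?_ hb hb'
  · intro a ha c hc hb'
    have := h a ha c hc
    rw [reesMonomial_mul] at this
    convert this using 2
    omega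
  · intro a ha c hc h1 h2 hb'
    have hle : L * J ^ n ≤ J ^ (n + 1) := by
      rw [pow_succ']; exact Ideal.mul_mono_left hL
    rw [reesMonomial_add J (n + 1) (hle ha) (hle hc)]
    exact Ideal.add_mem _ (h1 _) (h2 _)

theorem reesMonomial_mem_of_forall_one {J : Ideal B} (𝔮 : Ideal (reesAlgebra J))
    (h : ∀ a (ha : a ∈ J ^ 1), reesMonomial J 1 a ha ∈ 𝔮) (n : ℕ) (b : B) (hb : b ∈ J ^ (n + 1)) :
    reesMonomial J (n + 1) b hb ∈ 𝔮 :=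
  reesMonomial_succ_mem le_rfl 𝔮 (fun a ha _ _ => Ideal.mul_mem_right _ _ (h a (by simpa using ha)))
    b (by rwa [← pow_succ']) hb

theorem reesMax_le_of_forall {J 𝔫 : Ideal B} (𝔮 : Ideal (reesAlgebra J))
    (h0 : ∀ a ∈ 𝔫, algebraMap B _ a ∈ 𝔮)
    (h : ∀ a (ha : a ∈ J ^ 1), reesMonomial J 1 a ha ∈ 𝔮) : reesMax J 𝔫 ≤ 𝔮 := by
  intro f hf
  refine mem_of_forall_reesMonomial _ f fun n => ?_
  cases n with
  | zero =>
    convert h0 _ hf using 1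
    exact Subtype.ext (by rw [reesMonomial_val, monomial_zero_left]; rfl)
  | succ n => exact reesMonomial_mem_of_forall_one 𝔮 h n _ _

theorem reesMonomial_mem_pow (J : Ideal B) {c n : ℕ} (hcn : c ≤ n) (b : B) (hb : b ∈ J ^ n) :
    reesMonomial J n b hb ∈ reesMax J ⊥ ^ c := by
  induction c generalizing n b with
  | zero => simp
  | succ c ih =>
    obtain ⟨n, rfl⟩ : ∃ k, n = k + 1 := ⟨n - 1, by omega⟩
    refine reesMonomial_succ_mem le_rfl _ (fun a ha b hb => ?_) b (by rwa [← pow_succ']) hb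
    rw [pow_succ']
    exact Ideal.mul_mem_mul (reesMonomial_mem_reesMax one_ne_zero _) (ih (by omega) b hb)

/-- The linear map `a ↦ a X` from `L ≤ J` to the Rees algebra of `J`. -/
noncomputable def reesOne {L J : Ideal B} (hL : L ≤ J) : L →ₗ[B] reesAlgebra J where
  toFun a := reesMonomial J 1 a (by simpa using hL a.2)
  map_add' a b := Subtype.ext (by simp)
  map_smul' a b := Subtype.ext (by simp [smul_monomial])

/-- Saturation of a homogeneous ideal of the Rees algebra changes only finitely many degrees. -/
theorem exists_saturation [IsNoetherianRing B] (J 𝔠 : Ideal B) :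
    ∃ Q : Ideal (reesAlgebra J), reesQuot J 𝔠 ≤ Q ∧
      (∀ g, (∀ a ∈ reesMax J ⊥, a * g ∈ Q) → g ∈ Q) ∧
      ∃ N, ∀ f ∈ Q, ∀ n ≥ N, (f : B[X]).coeff n ∈ J ^ (n + 1) ⊔ 𝔠 := by
  -- Colons by powers of the irrelevant ideal; their stable value is the saturation.
  let T : ℕ →o Ideal (reesAlgebra J) :=
    { toFun := fun c => (reesQuot J 𝔠).colon ((reesMax J ⊥ ^ c : Ideal (reesAlgebra J)) : Set _)
      monotone' := fun a b hab => Submodule.colon_mono le_rfl (Ideal.pow_le_pow_right hab) }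
  have hT : ∀ c f, f ∈ T c ↔ ∀ a ∈ reesMax J ⊥ ^ c, f * a ∈ reesQuot J 𝔠 := fun c f =>
    Submodule.mem_colon
  obtain ⟨c, hc⟩ := monotone_stabilizes_iff_noetherian.2
    (inferInstance : IsNoetherian (reesAlgebra J) (reesAlgebra J)) T
  refine ⟨T c, fun f hf => (hT c f).2 fun a _ => Ideal.mul_mem_right _ _ hf, fun g hg => ?_, ?_⟩
  · rw [hc (c + 1) (by omega), hT]
    intro a ha
    rw [pow_succ'] at ha
    refine Submodule.mul_induction_on ha (fun x hx y hy => ?_) fun x y hx hy => ?_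
    · have := (hT c _).1 (hg x hx) y hy
      rwa [show g * (x * y) = x * g * y by ring]
    · rw [mul_add]; exact Ideal.add_mem _ hx hy
  · obtain ⟨s, hs⟩ := (isNoetherianRing_iff_ideal_fg _).1 inferInstance (T c)
    -- D bounds the degrees of the generators, so in degree at least D + c every multiplier has
    -- degree at least c and sends the generator into `reesQuot J 𝔠`.
    let D := s.sup fun g => (g : B[X]).natDegree
    refine ⟨D + c, fun f hf n hn => ?_⟩
    rw [← hs] at hf
    obtain ⟨r, -, rfl⟩ := Submodule.mem_span_finset.1 hf
    rw [AddSubmonoidClass.coe_finsetSum, finsetSum_coeff]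
    refine Ideal.sum_mem _ fun g hg => ?_
    rw [smul_eq_mul, MulMemClass.coe_mul, coeff_mul]
    refine Ideal.sum_mem _ ?_
    rintro ⟨i, j⟩ hij
    have hij : i + j = n := by simpa using hij
    by_cases hj : D < j
    · rw [coeff_eq_zero_of_natDegree_lt (lt_of_le_of_lt (Finset.le_sup (f := fun g :
        reesAlgebra J => (g : B[X]).natDegree) hg) hj), mul_zero]
      exact zero_mem _
    · have hg' : g ∈ T c := hs ▸ Submodule.subset_span hg
      have := (hT c g).1 hg' _ (reesMonomial_mem_pow J (show c ≤ i by omega)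
        (((r g : reesAlgebra J) : B[X]).coeff i) ((r g).2 i)) n
      rw [MulMemClass.coe_mul, reesMonomial_val, ← hij, mul_comm, add_comm i j,
        coeff_monomial_mul] at this
      rwa [← hij, add_comm i j]

/-- Over an infinite residue field, a general element of a reduction `K` of `J` has initial form
regular on `⨁ Kⁿ / (Kⁿ⁺¹ + 𝔠)` (when this has positive grade) and filter-regular on
`⨁ Jⁿ / (Jⁿ⁺¹ + 𝔠)`. -/
theorem exists_isRegMod_superficial [IsNoetherianRing B] [IsLocalRing B]
    [Infinite (ResidueField B)] {K J 𝔠 : Ideal B} (hKJ : K ≤ J) {m : ℕ}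
    (hm : K * J ^ m = J ^ (m + 1)) {s : ℕ} (hs : maximalIdeal B ^ s ≤ K)
    (hg : ∀ g, (∀ a ∈ reesMax K (maximalIdeal B), a * g ∈ reesQuot K 𝔠) → g ∈ reesQuot K 𝔠) :
    ∃ x, ∃ hx : x ∈ K ^ 1, IsRegMod (reesQuot K 𝔠) (reesMonomial K 1 x hx) ∧
      ∃ N, ∀ n ≥ N, ∀ b ∈ J ^ n, x * b ∈ J ^ (n + 2) ⊔ 𝔠 → b ∈ J ^ (n + 1) ⊔ 𝔠 := by
  obtain ⟨Q, hQle, hQsat, N, hN⟩ := exists_saturation J 𝔠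
  let S₁ := assPrimes (reesQuot K 𝔠)
  let S₂ := assPrimes Q
  have hfin : (Sum.inl '' S₁ ∪ Sum.inr '' S₂ :
      Set (Ideal (reesAlgebra K) ⊕ Ideal (reesAlgebra J))).Finite :=
    (assPrimes_finite.image _).union (assPrimes_finite.image _)
  -- V p collects the a ∈ K with aX ∈ p. An x outside all of these submodules has xX outside every
  -- associated prime of `reesQuot K 𝔠` and of the saturation Q.
  let V : Ideal (reesAlgebra K) ⊕ Ideal (reesAlgebra J) → Submodule B K :=
    Sum.elim (fun p => (p.restrictScalars B).comap (reesOne (le_refl K)))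
      (fun p => (p.restrictScalars B).comap (reesOne hKJ))
  have hV : ∀ i ∈ (Sum.inl '' S₁ ∪ Sum.inr '' S₂ :
      Set (Ideal (reesAlgebra K) ⊕ Ideal (reesAlgebra J))), V i ≠ ⊤ := by
    rintro _ (⟨p, hp, rfl⟩ | ⟨p, hp, rfl⟩) htop
    · obtain ⟨hpr, g, hgQ, hpg⟩ := exists_of_mem_assPrimes hp
      refine hgQ (hg g fun a ha => (hpg a).1 (reesMax_le_of_forall p ?_ ?_ ha))
      · intro a ha
        refine hpr.mem_of_pow_mem s ((hpg _).2 (Ideal.mul_mem_right _ _ ?_))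
        have h1 : a ^ s ∈ K := hs (Ideal.pow_mem_pow ha s)
        have h2 := Ideal.mem_map_of_mem (algebraMap B (reesAlgebra K)) h1
        rw [← reesQuot_bot, map_pow] at h2
        exact reesQuot_mono bot_le h2
      · intro a ha
        have : (⟨a, by simpa using ha⟩ : K) ∈ V (Sum.inl p) := htop ▸ Submodule.mem_top
        exact this
    · obtain ⟨hpr, g, hgQ, hpg⟩ := exists_of_mem_assPrimes hp
      have hK : ∀ a (ha : a ∈ K), reesMonomial J 1 a (by simpa using hKJ ha) ∈ p := by
        intro a ha
        have : (⟨a, ha⟩ : K) ∈ V (Sum.inr p) := htop ▸ Submodule.mem_top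
        exact this
      refine hgQ (hQsat g fun a ha => (hpg a).1 (reesMax_le_of_forall p ?_ ?_ ha))
      · intro a ha
        rw [Ideal.mem_bot.1 ha, map_zero]
        exact zero_mem _
      · intro a ha
        -- Only KX is known to lie in p; since KJᵐ = Jᵐ⁺¹, it contains (aX)ᵐ⁺¹ for every a ∈ J.
        refine hpr.mem_of_pow_mem (m + 1) ?_
        have hpow : ∀ k, reesMonomial J 1 a ha ^ k =
            reesMonomial J k (a ^ k) (Ideal.pow_mem_pow (by simpa using ha) k) := fun k =>
          Subtype.ext (by simp [monomial_pow])
        rw [hpow]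
        refine reesMonomial_succ_mem hKJ p (fun b hb c hc => Ideal.mul_mem_right _ _ (hK b hb)) _ ?_ _
        rw [hm]
        exact Ideal.pow_mem_pow (by simpa using ha) _
  obtain ⟨x, hx⟩ := exists_forall_notMem_of_ne_top hfin V hV
  have hx1 : (x : B) ∈ K ^ 1 := by simp
  refine ⟨x, hx1, isRegMod_of_forall_notMem fun p hp => hx (Sum.inl p) (Or.inl ⟨p, hp, rfl⟩),
    N, fun n hn b hb hxb => ?_⟩
  have hreg : IsRegMod Q (reesMonomial J 1 x (by simp [hKJ x.2])) :=
    isRegMod_of_forall_notMem fun p hp => hx (Sum.inr p) (Or.inr ⟨p, hp, rfl⟩)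
  have h1 : reesMonomial J n b hb ∈ Q := by
    refine hreg _ (hQle ?_)
    rw [reesMonomial_mul, reesMonomial_mem_reesQuot]
    convert hxb using 3
    omega
  simpa using hN _ h1 n hn

end Superficial

end RelHilbert

/-! ### Superficial sequences and lengths -/

namespace RelHilbert

open Polynomial IsLocalRing

variable {B : Type*} [CommRing B]

/-- The initial forms in degree one of the elements of `l` form a regular sequence on
`⨁ Jⁿ / (Jⁿ⁺¹ + 𝔠)`, expressed through colon ideals. -/
def FilRegSeq (J : Ideal B) : Ideal B → List B → Prop
  | _, [] => True
  | 𝔠, x :: l => x ∈ J ∧ (∀ n b, x * b ∈ J ^ (n + 1) ⊔ 𝔠 → b ∈ J ^ n ⊔ 𝔠) ∧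
      FilRegSeq J (𝔠 ⊔ Ideal.span {x}) l

/-- The variant of `FilRegSeq` where the colon conditions hold in large degrees. -/
def FilSupSeq (J : Ideal B) : Ideal B → List B → Prop
  | _, [] => True
  | 𝔠, x :: l => x ∈ J ∧ (∃ N, ∀ n ≥ N, ∀ b, x * b ∈ J ^ (n + 1) ⊔ 𝔠 → b ∈ J ^ n ⊔ 𝔠) ∧
      FilSupSeq J (𝔠 ⊔ Ideal.span {x}) l

theorem FilRegSeq.filSupSeq {J : Ideal B} {l : List B} {𝔠 : Ideal B} (h : FilRegSeq J 𝔠 l) :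
    FilSupSeq J 𝔠 l := by
  induction l generalizing 𝔠 with
  | nil => trivial
  | cons x l ih => exact ⟨h.1, ⟨0, fun n _ => h.2.1 n⟩, ih h.2.2⟩

theorem pow_le_pow_of_reduction {K J : Ideal B} {m : ℕ} (hm : K * J ^ m = J ^ (m + 1)) (k : ℕ) :
    J ^ (k + m) ≤ K ^ k := by
  have : J ^ (k + m) = K ^ k * J ^ m := by
    induction k with
    | zero => simp
    | succ k ih =>
      rw [show k + 1 + m = (k + m) + 1 by ring, pow_succ', ih, mul_left_comm, ← pow_succ', ← hm,
        pow_succ, mul_assoc]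
  rw [this]
  exact Ideal.mul_le_left (I := K ^ k)

/-- `GradeGE.exchange` ensures that whichever general element is chosen, the grade drops by exactly
the one needed to continue. -/
theorem exists_filSupSeq [IsNoetherianRing B] [IsLocalRing B]
    [Infinite (ResidueField B)] {K J : Ideal B} (hKJ : K ≤ J) {m : ℕ}
    (hm : K * J ^ m = J ^ (m + 1)) {s : ℕ} (hs : maximalIdeal B ^ s ≤ K) {d : ℕ} {𝔠 : Ideal B}
    (hg : GradeGE (reesMax K (maximalIdeal B)) (reesQuot K 𝔠) d) :
    ∃ l : List B, l.length = d ∧ FilRegSeq K 𝔠 l ∧ FilSupSeq J 𝔠 l := by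
  induction d generalizing 𝔠 with
  | zero => exact ⟨[], rfl, trivial, trivial⟩
  | succ d ih =>
    obtain ⟨x, hx, hreg, N, hN⟩ := exists_isRegMod_superficial hKJ hm hs
      fun g h => hg.mem_of_forall h
    have hreg' := mem_of_mul_mem_of_isRegMod hreg
    have hgr := hg.exchange (reesMonomial_mem_reesMax one_ne_zero hx) hreg
    rw [reesQuot_sup_span hx hreg'] at hgr
    obtain ⟨l, hl, hlK, hlJ⟩ := ih hgr
    rw [pow_one] at hx
    refine ⟨x :: l, by simp [hl], ⟨hx, hreg', hlK⟩, hKJ hx, ⟨N + m + 1, fun n hn b hb => ?_⟩, hlJ⟩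
    -- Regularity for K loses at most m degrees against J, because Jⁿ⁺¹ ⊆ Kⁿ⁻ᵐ⁺¹; filter-regularity
    -- for J then recovers them one by one.
    have h0 : b ∈ J ^ (n - m) ⊔ 𝔠 := by
      have hle : J ^ (n + 1) ⊔ 𝔠 ≤ K ^ (n - m + 1) ⊔ 𝔠 := by
        refine sup_le_sup_right ?_ _
        rw [show n + 1 = (n - m + 1) + m by omega]
        exact pow_le_pow_of_reduction hm _
      have hle' : K ^ (n - m) ⊔ 𝔠 ≤ J ^ (n - m) ⊔ 𝔠 := sup_le_sup_right (Ideal.pow_right_mono hKJ _) _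
      exact hle' (hreg' _ _ (hle hb))
    have key : ∀ j, n - m + j ≤ n → b ∈ J ^ (n - m + j) ⊔ 𝔠 := by
      intro j
      induction j with
      | zero => intro _; exact h0
      | succ j ihj =>
        intro hj
        obtain ⟨k, hk, c, hc, rfl⟩ := Submodule.mem_sup.1 (ihj (by omega))
        refine Ideal.add_mem _ (hN (n - m + j) (by omega) k hk ?_) (Ideal.mem_sup_right hc)
        have hle : J ^ (n + 1) ⊔ 𝔠 ≤ J ^ (n - m + j + 2) ⊔ 𝔠 :=
          sup_le_sup_right (Ideal.pow_le_pow_right (by omega)) _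
        have h2 : x * k = x * (k + c) - x * c := by ring
        rw [h2]
        exact Ideal.sub_mem _ (hle hb) (Ideal.mem_sup_right (𝔠.mul_mem_left _ hc))
    have := key m (by omega)
    rwa [Nat.sub_add_cancel (by omega)] at this

/-- Sally's descent: if `x` is superficial and the next element is regular modulo `x`, then `x`
is regular. -/
theorem FilSupSeq.sally {J 𝔠 : Ideal B} {x y : B} {l : List B} (h : FilSupSeq J 𝔠 (x :: l))
    (hyJ : y ∈ J)
    (hy : ∀ n b, y * b ∈ J ^ (n + 1) ⊔ (𝔠 ⊔ Ideal.span {x}) → b ∈ J ^ n ⊔ (𝔠 ⊔ Ideal.span {x})) :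
    ∀ n b, x * b ∈ J ^ (n + 1) ⊔ 𝔠 → b ∈ J ^ n ⊔ 𝔠 := by
  obtain ⟨hxJ, ⟨N, hN⟩, -⟩ := h
  have hypow : ∀ k n b, y ^ k * b ∈ J ^ (n + k) ⊔ (𝔠 ⊔ Ideal.span {x}) →
      b ∈ J ^ n ⊔ (𝔠 ⊔ Ideal.span {x}) := by
    intro k
    induction k with
    | zero => intro n b hb; simpa using hb
    | succ k ih =>
      intro n b hb
      refine ih n b (hy _ _ ?_)
      rwa [← mul_assoc, ← pow_succ']
  have hmul : ∀ k n b, b ∈ J ^ n ⊔ 𝔠 → y ^ k * b ∈ J ^ (n + k) ⊔ 𝔠 := by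
    intro k n b hb
    obtain ⟨j, hj, c, hc, rfl⟩ := Submodule.mem_sup.1 hb
    rw [mul_add, add_comm n k, pow_add]
    exact Ideal.add_mem _ (Ideal.mem_sup_left (Ideal.mul_mem_mul (Ideal.pow_mem_pow hyJ k) hj))
      (Ideal.mem_sup_right (𝔠.mul_mem_left _ hc))
  -- Modulo x, the power of y cancels and b = q + xb'. Multiplying by y^N reaches the degrees where
  -- x is known to cancel, which leaves the same problem for b' one degree lower; k must stay free
  -- because it grows to N + k.
  have key : ∀ n k b, y ^ k * b ∈ J ^ (n + k) ⊔ 𝔠 → b ∈ J ^ n ⊔ 𝔠 := by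
    intro n
    induction n with
    | zero => intro k b _; simp
    | succ n ih =>
      intro k b hb
      have hle : J ^ (n + 1 + k) ⊔ 𝔠 ≤ J ^ (n + 1 + k) ⊔ (𝔠 ⊔ Ideal.span {x}) :=
        sup_le_sup_left le_sup_left _
      have h1 := hypow k (n + 1) b (hle hb)
      rw [← sup_assoc] at h1
      obtain ⟨q, hq, b', rfl⟩ := mem_sup_span_singleton.1 h1
      have h2 : y ^ k * (x * b') ∈ J ^ (n + 1 + k) ⊔ 𝔠 := by
        have : y ^ k * (x * b') = y ^ k * (q + x * b') - y ^ k * q := by ring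
        rw [this]
        exact Ideal.sub_mem _ hb (hmul _ _ _ hq)
      have h3 : y ^ (N + k) * b' ∈ J ^ (n + (N + k)) ⊔ 𝔠 := by
        refine hN _ (by omega) _ ?_
        have := hmul N _ _ h2
        rw [show x * (y ^ (N + k) * b') = y ^ N * (y ^ k * (x * b')) by ring,
          show n + (N + k) + 1 = n + 1 + k + N by ring]
        exact this
      refine Ideal.add_mem _ hq ?_
      obtain ⟨j, hj, c, hc, rfl⟩ := Submodule.mem_sup.1 (ih _ _ h3)
      rw [mul_add, pow_succ']
      exact Ideal.add_mem _ (Ideal.mem_sup_left (Ideal.mul_mem_mul hxJ hj))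
        (Ideal.mem_sup_right (𝔠.mul_mem_left _ hc))
  intro n b hb
  refine key n N b (hN _ (by omega) _ ?_)
  have := hmul N _ _ hb
  rw [show x * (y ^ N * b) = y ^ N * (x * b) by ring, show n + N + 1 = n + 1 + N by ring]
  exact this

/-- The length of `B ⧸ 𝔟`. -/
noncomputable def idealLength (𝔟 : Ideal B) : ℕ := (Module.length B (B ⧸ 𝔟)).toNat

/-- The generating function of the lengths of `B ⧸ (Jⁿ⁺¹ + 𝔠)`. -/
noncomputable def lengthSeries (J 𝔠 : Ideal B) : PowerSeries ℤ :=
  PowerSeries.mk fun n => (idealLength (J ^ (n + 1) ⊔ 𝔠) : ℤ)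

theorem idealLength_top : idealLength (⊤ : Ideal B) = 0 := by
  have : Subsingleton (B ⧸ (⊤ : Ideal B)) := Ideal.Quotient.subsingleton_iff.2 rfl
  simp [idealLength, Module.length_eq_zero]

theorem length_quotient_eq_add {𝔟 𝔡 : Ideal B} (hle : 𝔟 ≤ 𝔡) :
    Module.length B (B ⧸ 𝔟) =
      Module.length B (𝔡 ⧸ 𝔟.submoduleOf 𝔡) + Module.length B (B ⧸ 𝔡) := by
  refine Module.length_eq_add_of_exact (Submodule.mapQ (𝔟.submoduleOf 𝔡) 𝔟 𝔡.subtype le_rfl)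
    (Submodule.factor hle) ?_ (Submodule.factor_surjective hle) ?_
  · rw [← LinearMap.ker_eq_bot]
    exact Submodule.ker_liftQ_eq_bot _ _ _ (by simp [LinearMap.ker_comp, Submodule.submoduleOf])
  · intro y
    obtain ⟨y, rfl⟩ := Submodule.Quotient.mk_surjective _ y
    change (Submodule.Quotient.mk y : B ⧸ 𝔡) = 0 ↔ _
    rw [Submodule.Quotient.mk_eq_zero]
    constructor
    · intro hy
      exact ⟨Submodule.Quotient.mk ⟨y, hy⟩, rfl⟩
    · rintro ⟨z, hz⟩
      obtain ⟨z, rfl⟩ := Submodule.Quotient.mk_surjective _ z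
      have h1 : (Submodule.Quotient.mk (z : B) : B ⧸ 𝔟) = Submodule.Quotient.mk y := hz
      rw [Submodule.Quotient.eq] at h1
      have := 𝔡.sub_mem z.2 (hle h1)
      simpa using this

/-- The exact sequence 0 → B/(𝔟 : x) → B/𝔟 → B/(𝔟 + (x)) → 0, its first map being multiplication by
x. -/
theorem length_quotient_colon (𝔟 : Ideal B) (x : B) :
    Module.length B (B ⧸ 𝔟) =
      Module.length B (B ⧸ 𝔟.colon {x}) + Module.length B (B ⧸ (𝔟 ⊔ Ideal.span {x})) := by
  have hmem : ∀ b, b ∈ 𝔟.colon {x} ↔ x * b ∈ 𝔟 := fun b => by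
    rw [Submodule.mem_colon_singleton, smul_eq_mul, mul_comm]
  refine Module.length_eq_add_of_exact
    (Submodule.mapQ (𝔟.colon {x}) 𝔟 (LinearMap.mulLeft B x) fun b hb => (hmem b).1 hb)
    (Submodule.factor le_sup_left) ?_ (Submodule.factor_surjective _) ?_
  · rw [← LinearMap.ker_eq_bot]
    exact Submodule.ker_liftQ_eq_bot _ _ _ fun b hb =>
      (hmem b).2 ((Submodule.Quotient.mk_eq_zero 𝔟).1 hb)
  · intro y
    obtain ⟨y, rfl⟩ := Submodule.Quotient.mk_surjective _ y
    change (Submodule.Quotient.mk y : B ⧸ (𝔟 ⊔ Ideal.span {x})) = 0 ↔ _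
    rw [Submodule.Quotient.mk_eq_zero, mem_sup_span_singleton]
    constructor
    · rintro ⟨q, hq, b, rfl⟩
      refine ⟨Submodule.Quotient.mk b, ?_⟩
      change (Submodule.Quotient.mk (x * b) : B ⧸ 𝔟) = _
      rw [Submodule.Quotient.eq]
      simpa using hq
    · rintro ⟨z, hz⟩
      obtain ⟨z, rfl⟩ := Submodule.Quotient.mk_surjective _ z
      have h1 : (Submodule.Quotient.mk (x * z) : B ⧸ 𝔟) = Submodule.Quotient.mk y := hz
      rw [Submodule.Quotient.eq] at h1
      exact ⟨y - x * z, by simpa using 𝔟.neg_mem h1, z, by ring⟩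

/-! ### Finite lengths and the comparison of generating functions. -/

section Length

variable [IsNoetherianRing B] [IsLocalRing B]

theorem isArtinianRing_quotient {𝔟 : Ideal B} {t : ℕ} (h : maximalIdeal B ^ t ≤ 𝔟) :
    IsArtinianRing (B ⧸ 𝔟) := by
  rcases subsingleton_or_nontrivial (B ⧸ 𝔟) with h0 | h0
  · infer_instance
  have : IsLocalRing (B ⧸ 𝔟) :=
    IsLocalRing.of_surjective' (Ideal.Quotient.mk 𝔟) Ideal.Quotient.mk_surjective
  rw [isArtinianRing_iff_isNilpotent_maximalIdeal]
  refine ⟨t, ?_⟩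
  have : maximalIdeal (B ⧸ 𝔟) = (maximalIdeal B).map (Ideal.Quotient.mk 𝔟) := by
    refine (IsLocalRing.eq_maximalIdeal ?_).symm
    refine (Ideal.map_eq_top_or_isMaximal_of_surjective _ Ideal.Quotient.mk_surjective
      (maximalIdeal.isMaximal B)).resolve_left fun htop => ?_
    have h2 := Ideal.comap_map_of_surjective' _ (Ideal.Quotient.mk_surjective (I := 𝔟))
      (maximalIdeal B)
    rw [htop, Ideal.comap_top, Ideal.mk_ker, sup_eq_left.2] at h2
    · exact (maximalIdeal.isMaximal B).ne_top h2.symm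
    · exact le_maximalIdeal (Ideal.Quotient.nontrivial_iff.1 h0)
  rw [this, ← Ideal.map_pow, Ideal.zero_eq_bot, Ideal.map_eq_bot_iff_le_ker, Ideal.mk_ker]
  exact h

theorem length_quotient_ne_top {𝔟 : Ideal B} {t : ℕ} (h : maximalIdeal B ^ t ≤ 𝔟) :
    Module.length B (B ⧸ 𝔟) ≠ ⊤ := by
  have := isArtinianRing_quotient h
  rw [Module.length_eq_of_surjective (R := B ⧸ 𝔟) (S := B) Ideal.Quotient.mk_surjective]
  exact Module.length_ne_top

theorem coe_idealLength {𝔟 : Ideal B} {t : ℕ} (h : maximalIdeal B ^ t ≤ 𝔟) :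
    (idealLength 𝔟 : ℕ∞) = Module.length B (B ⧸ 𝔟) :=
  ENat.natCast_toNat (length_quotient_ne_top h)

theorem idealLength_anti {𝔟 𝔡 : Ideal B} {t : ℕ} (h : maximalIdeal B ^ t ≤ 𝔟) (hle : 𝔟 ≤ 𝔡) :
    idealLength 𝔡 ≤ idealLength 𝔟 := by
  refine ENat.toNat_le_toNat ?_ (length_quotient_ne_top h)
  exact Module.length_le_of_surjective (Submodule.factor hle) (Submodule.factor_surjective hle)

theorem idealLength_eq_add {𝔟 𝔡 : Ideal B} {t : ℕ} (h : maximalIdeal B ^ t ≤ 𝔟) (hle : 𝔟 ≤ 𝔡) :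
    (idealLength 𝔟 : ℕ∞) = Module.length B (𝔡 ⧸ 𝔟.submoduleOf 𝔡) + idealLength 𝔡 := by
  rw [coe_idealLength h, coe_idealLength (h.trans hle), length_quotient_eq_add hle]

theorem eq_of_idealLength_eq {𝔟 𝔡 : Ideal B} {t : ℕ} (h : maximalIdeal B ^ t ≤ 𝔟) (hle : 𝔟 ≤ 𝔡)
    (heq : idealLength 𝔡 = idealLength 𝔟) : 𝔟 = 𝔡 := by
  have h1 := idealLength_eq_add h hle
  rw [heq] at h1
  have h2 : Module.length B (𝔡 ⧸ 𝔟.submoduleOf 𝔡) = 0 := by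
    refine (ENat.add_left_injective_of_ne_top (ENat.natCast_ne_top (idealLength 𝔟))) ?_
    simpa using h1.symm
  rw [Module.length_eq_zero_iff, Submodule.Quotient.subsingleton_iff,
    Submodule.submoduleOf_eq_top] at h2
  exact le_antisymm hle h2

theorem idealLength_colon {𝔟 : Ideal B} {t : ℕ} (h : maximalIdeal B ^ t ≤ 𝔟) (x : B) :
    idealLength 𝔟 = idealLength (𝔟.colon {x}) + idealLength (𝔟 ⊔ Ideal.span {x}) := by
  have h1 := length_quotient_colon 𝔟 x
  have h2 : 𝔟 ≤ 𝔟.colon {x} := fun b hb => by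
    rw [Submodule.mem_colon_singleton]
    exact Ideal.mul_mem_right _ _ hb
  rw [← coe_idealLength h, ← coe_idealLength (h.trans h2),
    ← coe_idealLength (h.trans le_sup_left)] at h1
  exact_mod_cast h1

/-- The effect on the length series of passing to the quotient by `x`. -/
theorem exists_lengthSeries_sub {J 𝔠 : Ideal B} {s : ℕ} (hs : maximalIdeal B ^ s ≤ J) {x : B}
    (hx : x ∈ J) (hsup : ∃ N, ∀ n ≥ N, ∀ b, x * b ∈ J ^ (n + 1) ⊔ 𝔠 → b ∈ J ^ n ⊔ 𝔠) :
    ∃ u : ℤ[X], (∀ n, 0 ≤ u.coeff n) ∧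
      (u = 0 ↔ ∀ n b, x * b ∈ J ^ (n + 1) ⊔ 𝔠 → b ∈ J ^ n ⊔ 𝔠) ∧
      (1 - PowerSeries.X) * lengthSeries J 𝔠 =
        lengthSeries J (𝔠 ⊔ Ideal.span {x}) - (u : PowerSeries ℤ) := by
  have hfin : ∀ n, maximalIdeal B ^ (s * n) ≤ J ^ n ⊔ 𝔠 := fun n => by
    rw [pow_mul]; exact (Ideal.pow_right_mono hs n).trans le_sup_left
  have hcol : ∀ n b, b ∈ (J ^ (n + 1) ⊔ 𝔠).colon {x} ↔ x * b ∈ J ^ (n + 1) ⊔ 𝔠 := fun n b => by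
    rw [Submodule.mem_colon_singleton, smul_eq_mul, mul_comm]
  have hle : ∀ n, J ^ n ⊔ 𝔠 ≤ (J ^ (n + 1) ⊔ 𝔠).colon {x} := fun n b hb => by
    rw [hcol]
    obtain ⟨j, hj, c, hc, rfl⟩ := Submodule.mem_sup.1 hb
    rw [mul_add, pow_succ']
    exact Ideal.add_mem _ (Ideal.mem_sup_left (Ideal.mul_mem_mul hx hj))
      (Ideal.mem_sup_right (𝔠.mul_mem_left _ hc))
  -- The length of ((Jⁿ⁺¹ + 𝔠) : x)/(Jⁿ + 𝔠), which measures the failure of x to cancel and vanishes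
  -- for large n.
  let v : ℕ → ℤ := fun n => idealLength (J ^ n ⊔ 𝔠) - idealLength ((J ^ (n + 1) ⊔ 𝔠).colon {x})
  have hv0 : ∀ n, 0 ≤ v n := fun n => by
    have := idealLength_anti (hfin n) (hle n)
    simp only [v]; omega
  have hviff : ∀ n, v n = 0 ↔ ∀ b, x * b ∈ J ^ (n + 1) ⊔ 𝔠 → b ∈ J ^ n ⊔ 𝔠 := by
    intro n
    constructor
    · intro h b hb
      have : idealLength ((J ^ (n + 1) ⊔ 𝔠).colon {x}) = idealLength (J ^ n ⊔ 𝔠) := by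
        simp only [v] at h; omega
      rw [eq_of_idealLength_eq (hfin n) (hle n) this]
      exact (hcol n b).2 hb
    · intro h
      have : J ^ n ⊔ 𝔠 = (J ^ (n + 1) ⊔ 𝔠).colon {x} :=
        le_antisymm (hle n) fun b hb => h b ((hcol n b).1 hb)
      simp only [v]
      rw [← this, sub_self]
  obtain ⟨N, hN⟩ := hsup
  let u : ℤ[X] := PowerSeries.trunc N (PowerSeries.mk v)
  have hu : ∀ n, u.coeff n = v n := by
    intro n
    rw [PowerSeries.coeff_trunc, PowerSeries.coeff_mk]
    split_ifs with h
    · rfl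
    · exact ((hviff n).2 (hN n (by omega))).symm
  refine ⟨u, fun n => hu n ▸ hv0 n, ?_, ?_⟩
  · rw [Polynomial.ext_iff]
    simp only [hu, coeff_zero, hviff]
  · ext n
    rw [sub_mul, one_mul, map_sub, map_sub, Polynomial.coeff_coe, hu]
    have h1 := idealLength_colon (hfin (n + 1)) x
    rw [sup_assoc] at h1
    cases n with
    | zero =>
      -- No preceding coefficient exists here, in agreement with B/(J⁰ + 𝔠) = 0.
      rw [PowerSeries.coeff_zero_X_mul]
      simp only [lengthSeries, PowerSeries.coeff_mk, v, h1]
      simp [idealLength_top, add_comm]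
    | succ n =>
      rw [PowerSeries.coeff_succ_X_mul]
      simp only [lengthSeries, PowerSeries.coeff_mk, v, h1]
      push_cast
      ring

/-- The `h`-series is a polynomial. -/
theorem FilSupSeq.exists_polynomial {J : Ideal B} {s : ℕ} (hs : maximalIdeal B ^ s ≤ J) {l : List B}
    {N : ℕ} {𝔠 : Ideal B} (h : FilSupSeq J 𝔠 l) (hN : J ^ N ≤ 𝔠 ⊔ Ideal.ofList l) :
    ∃ p : ℤ[X], (p : PowerSeries ℤ) = (1 - PowerSeries.X) ^ (l.length + 1) * lengthSeries J 𝔠 := by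
  induction l generalizing 𝔠 with
  | nil =>
    rw [Ideal.ofList_nil, sup_bot_eq] at hN
    refine ⟨PowerSeries.trunc (N + 1) ((1 - PowerSeries.X) * lengthSeries J 𝔠), ?_⟩
    rw [List.length_nil, zero_add, pow_one]
    ext n
    rw [Polynomial.coeff_coe, PowerSeries.coeff_trunc]
    split_ifs with hn
    · rfl
    · obtain ⟨n, rfl⟩ : ∃ k, n = k + 1 := ⟨n - 1, by omega⟩
      rw [sub_mul, one_mul, map_sub, PowerSeries.coeff_succ_X_mul]
      simp only [lengthSeries, PowerSeries.coeff_mk]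
      rw [sup_eq_right.2 ((Ideal.pow_le_pow_right (by omega)).trans hN),
        sup_eq_right.2 ((Ideal.pow_le_pow_right (by omega)).trans hN), sub_self]
  | cons x l ih =>
    rw [Ideal.ofList_cons, ← sup_assoc] at hN
    obtain ⟨p, hp⟩ := ih h.2.2 hN
    obtain ⟨u, -, -, hu⟩ := exists_lengthSeries_sub hs h.1 h.2.1
    refine ⟨p - (1 - X) ^ (l.length + 1) * u, ?_⟩
    rw [List.length_cons, pow_succ _ (l.length + 1), mul_assoc, hu, mul_sub, ← hp]
    simp

/-- The comparison of the two filtrations. -/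
theorem exists_polynomial_comparison {K J : Ideal B} (hKJ : K ≤ J) {s : ℕ}
    (hs : maximalIdeal B ^ s ≤ K) {l : List B} {N : ℕ} {𝔠 : Ideal B} (h𝔠 : 𝔠 ≤ K)
    (hK : FilRegSeq K 𝔠 l) (hJ : FilSupSeq J 𝔠 l) (hN : J ^ N ≤ 𝔠 ⊔ Ideal.ofList l)
    (hNK : K ^ N ≤ 𝔠 ⊔ Ideal.ofList l) :
    ∃ g : ℤ[X], (g : PowerSeries ℤ) =
        (1 - PowerSeries.X) ^ l.length * (lengthSeries K 𝔠 - lengthSeries J 𝔠) ∧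
      (idealLength K : ℤ) - idealLength J ≤ g.eval 1 ∧
      (g.eval 1 = (idealLength K : ℤ) - idealLength J → FilRegSeq J 𝔠 l) := by
  induction l generalizing 𝔠 with
  | nil =>
    rw [Ideal.ofList_nil, sup_bot_eq] at hN hNK
    let g : ℤ[X] := PowerSeries.trunc (N + 1) (lengthSeries K 𝔠 - lengthSeries J 𝔠)
    have hcoeff : ∀ n, g.coeff n =
        (idealLength (K ^ (n + 1) ⊔ 𝔠) : ℤ) - idealLength (J ^ (n + 1) ⊔ 𝔠) := by
      intro n
      rw [PowerSeries.coeff_trunc]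
      split_ifs with hn
      · simp [lengthSeries]
      · rw [sup_eq_right.2 ((Ideal.pow_le_pow_right (by omega)).trans hN),
          sup_eq_right.2 ((Ideal.pow_le_pow_right (by omega)).trans hNK), sub_self]
    have hnn : ∀ n, 0 ≤ g.coeff n := by
      intro n
      rw [hcoeff]
      have h1 : maximalIdeal B ^ (s * (n + 1)) ≤ K ^ (n + 1) ⊔ 𝔠 := by
        rw [pow_mul]; exact (Ideal.pow_right_mono hs _).trans le_sup_left
      have := idealLength_anti h1 (sup_le_sup_right (Ideal.pow_right_mono hKJ (n + 1)) 𝔠)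
      omega
    refine ⟨g, ?_, ?_, fun _ => trivial⟩
    · ext n
      rw [Polynomial.coeff_coe, hcoeff]
      simp [lengthSeries]
    · rw [Polynomial.eval_eq_sum_range]
      -- The degree zero term alone is λ(J/K), because 𝔠 ⊆ K; the other coefficients only add to
      -- g(1).
      have h0 : (idealLength K : ℤ) - idealLength J = g.coeff 0 := by
        rw [hcoeff, zero_add, pow_one, pow_one, sup_eq_left.2 h𝔠, sup_eq_left.2 (h𝔠.trans hKJ)]
      rw [h0]
      simp only [one_pow, mul_one]
      exact Finset.single_le_sum (f := fun n => g.coeff n) (fun n _ => hnn n) (by simp)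
  | cons x l ih =>
    rw [Ideal.ofList_cons, ← sup_assoc] at hN hNK
    obtain ⟨g, hg, hg1, hg2⟩ := ih (sup_le h𝔠 (by
      rw [Ideal.span_singleton_le_iff_mem]; exact hK.1)) hK.2.2 hJ.2.2 hN hNK
    obtain ⟨u, -, hu0, hu⟩ := exists_lengthSeries_sub hs hK.1 ⟨0, fun n _ => hK.2.1 n⟩
    rw [hu0.2 hK.2.1, Polynomial.coe_zero, sub_zero] at hu
    obtain ⟨v, hv, hv0, hvs⟩ := exists_lengthSeries_sub (hs.trans hKJ) hJ.1 hJ.2.1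
    -- K contributes no error and J contributes v; at z = 1 the factor removes v unless x is the
    -- last element.
    refine ⟨g + (1 - X) ^ l.length * v, ?_, ?_, ?_⟩
    · rw [List.length_cons, pow_succ, mul_assoc, mul_sub (1 - PowerSeries.X), hu, hvs]
      simp only [Polynomial.coe_add, hg, Polynomial.coe_mul, Polynomial.coe_pow,
        Polynomial.coe_sub, Polynomial.coe_one, Polynomial.coe_X]
      ring
    all_goals
      cases l with
      | nil =>
        have hsum : v.eval 1 = ∑ n ∈ Finset.range (v.natDegree + 1), v.coeff n := by
          rw [Polynomial.eval_eq_sum_range]; simp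
        have hnn : 0 ≤ v.eval 1 := hsum ▸ Finset.sum_nonneg fun n _ => hv n
        simp only [List.length_nil, pow_zero, one_mul, eval_add]
        first
        | exact le_add_of_le_of_nonneg hg1 hnn
        | intro heq
          have hz : v.eval 1 = 0 := by linarith
          refine ⟨hJ.1, hv0.1 ?_, trivial⟩
          rw [hsum, Finset.sum_eq_zero_iff_of_nonneg fun n _ => hv n] at hz
          ext n
          by_cases hn : n ∈ Finset.range (v.natDegree + 1)
          · rw [hz n hn, coeff_zero]
          · rw [coeff_zero, coeff_eq_zero_of_natDegree_lt (by simpa using hn)]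
      | cons y l =>
        simp only [List.length_cons, eval_add, eval_mul, eval_pow, eval_sub, eval_one, eval_X,
          sub_self, ne_eq, Nat.add_eq_zero_iff, one_ne_zero, and_false, not_false_eq_true, zero_pow,
          zero_mul, add_zero]
        first
        | exact hg1
        | intro heq
          have hreg := hg2 heq
          -- Induction makes the initial form of y regular modulo x; Sally's descent returns this to
          -- x.
          exact ⟨hJ.1, hJ.sally hreg.1 hreg.2.1, hreg⟩

end Length

end RelHilbert

/-! ### First Hilbert coefficients and the Cohen-Macaulay property -/

namespace RelHilbert

open Polynomial IsLocalRing

section HilbertCoeff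

theorem finsum_choose_one_mul_coeff (p : ℤ[X]) :
    ∑ᶠ k : ℕ, (k.choose 1 : ℤ) * PowerSeries.coeff k (p : PowerSeries ℤ) =
      p.derivative.eval 1 := by
  rw [derivative_eval, Polynomial.sum_def, finsum_eq_sum_of_support_subset (s := p.support)]
  · refine Finset.sum_congr rfl fun k _ => ?_
    rw [Polynomial.coeff_coe, Nat.choose_one_right, one_pow, mul_one, mul_comm]
  · intro k hk
    rw [Function.mem_support, Polynomial.coeff_coe] at hk
    exact Finset.mem_coe.2 (mem_support_iff.2 (right_ne_zero_of_mul hk))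

variable {B : Type*} [CommRing B]

theorem hSeries_eq (J : Ideal B) (d : ℕ) :
    hSeries J B d = (1 - PowerSeries.X) ^ (d + 1) * lengthSeries J ⊥ := by
  have : ∀ n, hilbertSamuel J B n = idealLength (J ^ (n + 1) ⊔ ⊥) := fun n => by
    rw [hilbertSamuel, idealLength, sup_bot_eq, smul_eq_mul, Ideal.mul_top]
  rw [hSeries, lengthSeries]
  simp only [this]

variable [IsNoetherianRing B] [IsLocalRing B]

/-- Comparison of the first Hilbert coefficients of `J` and its reduction `K` in the presence of a
suitable superficial sequence. -/
theorem hilbertCoeff_one_comparison {K J : Ideal B} (hKJ : K ≤ J) {m : ℕ}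
    (hm : K * J ^ m = J ^ (m + 1)) {s : ℕ} (hs : maximalIdeal B ^ s ≤ K) {l : List B} {N : ℕ}
    (hK : FilRegSeq K ⊥ l) (hJ : FilSupSeq J ⊥ l) (hN : K ^ N ≤ Ideal.ofList l) :
    (idealLength K : ℤ) - idealLength J ≤
        hilbertCoeff J B l.length 1 - hilbertCoeff K B l.length 1 ∧
      (hilbertCoeff J B l.length 1 - hilbertCoeff K B l.length 1 =
        (idealLength K : ℤ) - idealLength J → FilRegSeq J ⊥ l) := by
  have hNJ : J ^ (N + m) ≤ ⊥ ⊔ Ideal.ofList l := by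
    rw [bot_sup_eq]; exact (pow_le_pow_of_reduction hm N).trans hN
  have hNK : K ^ (N + m) ≤ ⊥ ⊔ Ideal.ofList l := (Ideal.pow_right_mono hKJ _).trans hNJ
  obtain ⟨p, hp⟩ := hJ.exists_polynomial (hs.trans hKJ) hNJ
  obtain ⟨q, hq⟩ := hK.filSupSeq.exists_polynomial hs hNK
  obtain ⟨g, hg, hg1, hg2⟩ := exists_polynomial_comparison hKJ hs bot_le hK hJ hNJ hNK
  -- h_J = h_K − (1 − z)g, so differentiating at z = 1 gives e₁(J) − e₁(K) = g(1).
  have hpq : p = q - (1 - X) * g := by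
    apply Polynomial.coe_injective
    simp only [Polynomial.coe_sub, Polynomial.coe_mul, Polynomial.coe_one, Polynomial.coe_X, hp,
      hq, hg]
    ring
  have hE : hilbertCoeff J B l.length 1 - hilbertCoeff K B l.length 1 = g.eval 1 := by
    rw [hilbertCoeff, hilbertCoeff, hSeries_eq, hSeries_eq, ← hp, ← hq,
      finsum_choose_one_mul_coeff, finsum_choose_one_mul_coeff, hpq]
    simp
  rw [hE]
  exact ⟨hg1, hg2⟩

end HilbertCoeff

/-! ### The Cohen–Macaulay property through height and grade. -/

section CohenMacaulay

theorem RegSeqMod.length_le_ringKrullDim {R : Type*} [CommRing R] [IsNoetherianRing R]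
    [IsLocalRing R] {l : List R} (h : RegSeqMod ⊥ l) (hl : ∀ x ∈ l, x ∈ maximalIdeal R) :
    RingTheory.Sequence.IsRegular R l ∧
      ringKrullDim (R ⧸ Ideal.ofList l) + l.length = ringKrullDim R := by
  have hreg : RingTheory.Sequence.IsRegular R l :=
    (IsLocalRing.isRegular_iff_isWeaklyRegular_of_subset_maximalIdeal hl).2
      ((isWeaklyRegular_iff_regSeqMod l).2 h)
  exact ⟨hreg, ringKrullDim_add_length_eq_ringKrullDim_of_isRegular l hreg⟩

theorem GradeGE.le_ringKrullDim {R : Type*} [CommRing R] [IsNoetherianRing R]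
    [IsLocalRing R] {d : ℕ} (h : GradeGE (maximalIdeal R) ⊥ d) : (d : WithBot ℕ∞) ≤ ringKrullDim R := by
  obtain ⟨l, rfl, hm, hr⟩ := h
  obtain ⟨hreg, hdim⟩ := hr.length_le_ringKrullDim hm
  rw [← hdim]
  have : Nontrivial (R ⧸ Ideal.ofList l) :=
    Ideal.Quotient.nontrivial_iff.2 fun h => hreg.top_ne_smul (by simp [h])
  exact le_add_of_nonneg_left ringKrullDim_nonneg_of_nontrivial

theorem isCohenMacaulayLocalRing_iff {R : Type*} [CommRing R] [IsLocalRing R] :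
    IsCohenMacaulayLocalRing R ↔
      IsNoetherianRing R ∧ ∃ d : ℕ, ringKrullDim R = d ∧ GradeGE (maximalIdeal R) ⊥ d := by
  refine and_congr_right fun hN => ?_
  constructor
  · rintro ⟨rs, hm, hr, hd⟩
    exact ⟨rs.length, hd.symm, rs, rfl, hm, (isWeaklyRegular_iff_regSeqMod rs).1 hr.1⟩
  · rintro ⟨d, hd, l, rfl, hm, hr⟩
    exact ⟨l, hm, (hr.length_le_ringKrullDim hm).1, hd.symm⟩

variable {R : Type*} [CommRing R] [IsNoetherianRing R]

theorem gradeGE_localization_iff {P : Ideal R} [hP : P.IsMaximal] {d : ℕ} :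
    GradeGE (maximalIdeal (Localization.AtPrime P)) ⊥ d ↔ GradeGE P ⊥ d := by
  have : IsNoetherianRing (Localization.AtPrime P) :=
    IsLocalization.isNoetherianRing P.primeCompl _ inferInstance
  have : Module.Flat R (Localization.AtPrime P) :=
    IsLocalization.flat (Localization.AtPrime P) P.primeCompl
  rw [← Localization.AtPrime.map_eq_maximalIdeal,
    ← Ideal.map_bot (f := algebraMap R (Localization.AtPrime P))]
  constructor
  · refine GradeGE.of_map_of_flat ?_
    rw [Localization.AtPrime.map_eq_maximalIdeal]
    exact (maximalIdeal.isMaximal _).ne_top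
  · exact GradeGE.map_of_flat

/-- Grade at a maximal ideal is unchanged by localization and by lifting along R → R/Q, so it can be
computed in R modulo Q. -/
theorem isCohenMacaulayRing_quotient_iff {Q : Ideal R} :
    IsCohenMacaulayRing (R ⧸ Q) ↔ ∀ M : Ideal R, M.IsMaximal → Q ≤ M →
      ∃ d : ℕ, (M.map (Ideal.Quotient.mk Q)).height = d ∧ GradeGE M Q d := by
  have hcomap : ∀ M : Ideal R, Q ≤ M → (M.map (Ideal.Quotient.mk Q)).comap (Ideal.Quotient.mk Q) = M :=
    fun M hM => by
      rw [Ideal.comap_map_of_surjective' _ Ideal.Quotient.mk_surjective, Ideal.mk_ker,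
        sup_eq_left.2 hM]
  have key : ∀ (P : Ideal (R ⧸ Q)) [P.IsMaximal], IsCohenMacaulayLocalRing (Localization.AtPrime P) ↔
      ∃ d : ℕ, P.height = d ∧ GradeGE (P.comap (Ideal.Quotient.mk Q)) Q d := by
    intro P hP
    have hN : IsNoetherianRing (Localization.AtPrime P) :=
      IsLocalization.isNoetherianRing P.primeCompl _ inferInstance
    rw [isCohenMacaulayLocalRing_iff, and_iff_right hN]
    refine exists_congr fun d => and_congr ?_ ?_
    · rw [IsLocalization.AtPrime.ringKrullDim_eq_height P]
      exact_mod_cast Iff.rfl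
    · rw [gradeGE_localization_iff]
      have h0 : (⊥ : Ideal (R ⧸ Q)).comap (Ideal.Quotient.mk Q) = Q := by
        rw [← RingHom.ker_eq_comap_bot, Ideal.mk_ker]
      constructor
      · intro h
        have := h.comap_of_surjective (f := Ideal.Quotient.mk Q) Ideal.Quotient.mk_surjective
        rwa [h0] at this
      · intro h
        refine GradeGE.of_comap_of_surjective (f := Ideal.Quotient.mk Q)
          Ideal.Quotient.mk_surjective ?_
        rwa [h0]
  constructor
  · rintro ⟨-, h⟩ M hM hQM
    have hmax : (M.map (Ideal.Quotient.mk Q)).IsMaximal := by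
      refine (Ideal.map_eq_top_or_isMaximal_of_surjective _ Ideal.Quotient.mk_surjective
        hM).resolve_left fun htop => hM.ne_top ?_
      rw [← hcomap M hQM, htop, Ideal.comap_top]
    obtain ⟨d, hd, hg⟩ := (key (M.map (Ideal.Quotient.mk Q))).1 (h _)
    rw [hcomap M hQM] at hg
    exact ⟨d, hd, hg⟩
  · intro h
    refine ⟨inferInstance, fun P hP => (key P).2 ?_⟩
    have hmax := Ideal.comap_isMaximal_of_surjective (Ideal.Quotient.mk Q)
      Ideal.Quotient.mk_surjective (K := P)
    have hle : Q ≤ P.comap (Ideal.Quotient.mk Q) := by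
      have := Ideal.ker_le_comap (K := P) (Ideal.Quotient.mk Q)
      rwa [Ideal.mk_ker] at this
    obtain ⟨d, hd, hg⟩ := h _ hmax hle
    rw [Ideal.map_comap_of_surjective _ Ideal.Quotient.mk_surjective] at hd
    exact ⟨d, hd, hg⟩

/-- A prime whose height is at most the length of a regular sequence it contains is minimal over
that sequence. -/
theorem exists_pow_le_of_height_le {P : Ideal R} [P.IsPrime] {l : List R} (hl : ∀ x ∈ l, x ∈ P)
    (hr : RegSeqMod ⊥ l) (hP : P.height ≤ l.length) :
    ∃ t : ℕ, ∀ a ∈ P ^ t, ∃ s ∉ P, s * a ∈ Ideal.ofList l := by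
  let A := Localization.AtPrime P
  have : IsNoetherianRing A := IsLocalization.isNoetherianRing P.primeCompl _ inferInstance
  have : Module.Flat R A := IsLocalization.flat A P.primeCompl
  have hr' : RegSeqMod ⊥ (l.map (algebraMap R A)) := by
    have := hr.map_of_flat (S := A)
    rwa [Ideal.map_bot] at this
  have hm : ∀ x ∈ l.map (algebraMap R A), x ∈ maximalIdeal A := by
    intro x hx
    obtain ⟨y, hy, rfl⟩ := List.mem_map.1 hx
    rw [← Localization.AtPrime.map_eq_maximalIdeal]
    exact Ideal.mem_map_of_mem _ (hl y hy)
  obtain ⟨hreg, hdim⟩ := hr'.length_le_ringKrullDim hm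
  rw [IsLocalization.AtPrime.ringKrullDim_eq_height P A] at hdim
  let 𝔩 := Ideal.ofList (l.map (algebraMap R A))
  have hnt : Nontrivial (A ⧸ 𝔩) :=
    Ideal.Quotient.nontrivial_iff.2 fun h => hreg.top_ne_smul (by simp [𝔩, h])
  -- The sequence uses up the whole dimension, which is P.height; the quotient is therefore Artinian
  -- with nilpotent maximal ideal.
  have hdim0 : ringKrullDim (A ⧸ 𝔩) ≤ 0 := by
    have h1 : ringKrullDim (A ⧸ 𝔩) + l.length ≤ (l.length : WithBot ℕ∞) := by
      rw [List.length_map] at hdim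
      rw [hdim]
      exact_mod_cast hP
    have h2 : ringKrullDim (A ⧸ 𝔩) ≠ ⊥ := fun h => by
      have := ringKrullDim_nonneg_of_nontrivial (R := A ⧸ 𝔩)
      simp [h] at this
    obtain ⟨k, hk⟩ := WithBot.ne_bot_iff_exists.1 h2
    rw [← hk] at h1 ⊢
    have h3 : k + (l.length : ℕ∞) ≤ (l.length : ℕ∞) := by exact_mod_cast h1
    cases k with
    | top => simp at h3
    | coe k =>
      have h4 : k + l.length ≤ l.length := by exact_mod_cast h3
      obtain rfl : k = 0 := by omega
      simp
  have : IsLocalRing (A ⧸ 𝔩) :=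
    IsLocalRing.of_surjective' (Ideal.Quotient.mk 𝔩) Ideal.Quotient.mk_surjective
  have : Ring.KrullDimLE 0 (A ⧸ 𝔩) := by
    rw [Ring.krullDimLE_iff]; exact_mod_cast hdim0
  have hart : IsArtinianRing (A ⧸ 𝔩) := isArtinianRing_iff_krullDimLE_zero.2 this
  obtain ⟨t, ht⟩ := (isArtinianRing_iff_isNilpotent_maximalIdeal _).1 hart
  refine ⟨t, fun a ha => ?_⟩
  have hle : P.map (algebraMap R A) ≤ (maximalIdeal (A ⧸ 𝔩)).comap (Ideal.Quotient.mk 𝔩) := by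
    rw [Localization.AtPrime.map_eq_maximalIdeal]
    have := Ideal.comap_isMaximal_of_surjective (Ideal.Quotient.mk 𝔩)
      Ideal.Quotient.mk_surjective (K := maximalIdeal (A ⧸ 𝔩))
    exact (IsLocalRing.eq_maximalIdeal this).ge
  have h1 : Ideal.Quotient.mk 𝔩 (algebraMap R A a) ∈ maximalIdeal (A ⧸ 𝔩) ^ t := by
    have h2 := Ideal.mem_map_of_mem (Ideal.Quotient.mk 𝔩) (Ideal.mem_map_of_mem (algebraMap R A) ha)
    rw [Ideal.map_pow, Ideal.map_pow] at h2
    exact Ideal.pow_right_mono (Ideal.map_le_iff_le_comap.2 hle) t h2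
  rw [ht, Ideal.zero_eq_bot, Ideal.mem_bot, Ideal.Quotient.eq_zero_iff_mem] at h1
  have h2 : algebraMap R A a ∈ (Ideal.ofList l).map (algebraMap R A) := by
    rwa [Ideal.map_ofList]
  rw [IsLocalization.algebraMap_mem_map_algebraMap_iff P.primeCompl] at h2
  obtain ⟨s, hs, h⟩ := h2
  exact ⟨s, hs, h⟩

end CohenMacaulay

end RelHilbert

/-! ### Regular sequences of initial forms -/

namespace RelHilbert

open Polynomial IsLocalRing

variable {B : Type*} [CommRing B]

theorem FilRegSeq.exists_lift {J : Ideal B} {l : List B} {𝔠 : Ideal B} (h : FilRegSeq J 𝔠 l) :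
    ∃ L : List (reesAlgebra J), L.map Subtype.val = l.map (monomial 1) ∧
      RegSeqMod (reesQuot J 𝔠) L ∧
      reesQuot J 𝔠 ⊔ Ideal.ofList L = reesQuot J (𝔠 ⊔ Ideal.ofList l) := by
  induction l generalizing 𝔠 with
  | nil => exact ⟨[], rfl, trivial, by simp⟩
  | cons x l ih =>
    have hx : x ∈ J ^ 1 := by simpa using h.1
    obtain ⟨L, hL, hreg, hsup⟩ := ih h.2.2
    have h1 := reesQuot_sup_span hx h.2.1
    refine ⟨reesMonomial J 1 x hx :: L, by simp [hL], ⟨isRegMod_reesQuot_of_forall hx h.2.1, ?_⟩, ?_⟩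
    · rwa [h1]
    · rw [Ideal.ofList_cons, Ideal.ofList_cons, ← sup_assoc, ← sup_assoc, h1, hsup]

theorem exists_val_eq_of_map_val_eq {J : Ideal B} {l : List B} {L : List (reesAlgebra J)}
    (hL : L.map Subtype.val = l.map (monomial 1)) : ∀ ξ ∈ L, ∃ x ∈ l, (ξ : B[X]) = monomial 1 x := by
  intro ξ hξ
  have : (ξ : B[X]) ∈ l.map (monomial 1) := hL ▸ List.mem_map_of_mem hξ
  obtain ⟨x, hx, h⟩ := List.mem_map.1 this
  exact ⟨x, hx, h.symm⟩

theorem FilRegSeq.mem {K : Ideal B} {l : List B} {𝔠 : Ideal B}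
    (h : FilRegSeq K 𝔠 l) : ∀ x ∈ l, x ∈ K := by
  induction l generalizing 𝔠 with
  | nil => simp
  | cons x l ih =>
    intro y hy
    rcases List.mem_cons.1 hy with rfl | hy
    · exact h.1
    · exact ih h.2.2 y hy

variable [IsNoetherianRing B] [IsLocalRing B]

theorem mem_of_forall_mem_pow_sup {K 𝔠 : Ideal B} (hK : K ≠ ⊤) {b : B}
    (h : ∀ n, b ∈ K ^ n ⊔ 𝔠) : b ∈ 𝔠 := by
  rw [← Submodule.Quotient.mk_eq_zero 𝔠, ← Submodule.mem_bot B,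
    ← Ideal.iInf_pow_smul_eq_bot_of_isLocalRing (M := B ⧸ 𝔠) K hK, Submodule.mem_iInf]
  intro n
  obtain ⟨k, hk, c, hc, rfl⟩ := Submodule.mem_sup.1 (h n)
  rw [Submodule.Quotient.mk_add, (Submodule.Quotient.mk_eq_zero 𝔠).2 hc, add_zero]
  have : (Submodule.Quotient.mk k : B ⧸ 𝔠) = k • Submodule.Quotient.mk 1 := by
    rw [← Submodule.Quotient.mk_smul, smul_eq_mul, mul_one]
  rw [this]
  exact Submodule.smul_mem_smul hk trivial

/-- If xy ∈ 𝔠, the colon conditions put y in every Kⁿ + 𝔠, and Krull's intersection theorem applies.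
-/
theorem FilRegSeq.regSeqMod {K : Ideal B} (hK : K ≠ ⊤) {l : List B} {𝔠 : Ideal B}
    (h : FilRegSeq K 𝔠 l) : RegSeqMod 𝔠 l := by
  induction l generalizing 𝔠 with
  | nil => trivial
  | cons x l ih =>
    exact ⟨fun y hy => mem_of_forall_mem_pow_sup hK fun n => h.2.1 n y (Ideal.mem_sup_right hy),
      ih h.2.2⟩

theorem RegSeqMod.exists_pow_le_of_height_le {R : Type*} [CommRing R] [IsNoetherianRing R]
    {Q M : Ideal R} [hM : M.IsMaximal] (hQM : Q ≤ M) {l : List R} (hl : ∀ x ∈ l, x ∈ M)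
    (hr : RegSeqMod Q l) (hht : (M.map (Ideal.Quotient.mk Q)).height ≤ l.length) :
    ∃ t : ℕ, ∀ a ∈ M ^ t, ∃ f ∉ M, f * a ∈ Q ⊔ Ideal.ofList l := by
  have hcomap : (M.map (Ideal.Quotient.mk Q)).comap (Ideal.Quotient.mk Q) = M := by
    rw [Ideal.comap_map_of_surjective' _ Ideal.Quotient.mk_surjective, Ideal.mk_ker,
      sup_eq_left.2 hQM]
  have hPmax : (M.map (Ideal.Quotient.mk Q)).IsMaximal := by
    refine (Ideal.map_eq_top_or_isMaximal_of_surjective _ Ideal.Quotient.mk_surjective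
      hM).resolve_left fun htop => hM.ne_top ?_
    rw [← hcomap, htop, Ideal.comap_top]
  have hreg' : RegSeqMod ⊥ (l.map (Ideal.Quotient.mk Q)) := by
    refine RegSeqMod.map_of_surjective Ideal.Quotient.mk_surjective ?_
    rwa [← RingHom.ker_eq_comap_bot, Ideal.mk_ker]
  obtain ⟨t, ht⟩ := RelHilbert.exists_pow_le_of_height_le (P := M.map (Ideal.Quotient.mk Q))
    (l := l.map (Ideal.Quotient.mk Q)) (by
      intro y hy
      obtain ⟨ξ, hξ, rfl⟩ := List.mem_map.1 hy
      exact Ideal.mem_map_of_mem _ (hl ξ hξ)) hreg' (by rwa [List.length_map])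
  refine ⟨t, fun a ha => ?_⟩
  have h2 := Ideal.mem_map_of_mem (Ideal.Quotient.mk Q) ha
  rw [Ideal.map_pow] at h2
  obtain ⟨s, hs, hsa⟩ := ht _ h2
  obtain ⟨f, rfl⟩ := Ideal.Quotient.mk_surjective s
  refine ⟨f, fun hf => hs (Ideal.mem_map_of_mem _ hf), ?_⟩
  rwa [← map_mul, ← Ideal.map_ofList, ← Ideal.mem_comap,
    Ideal.comap_map_of_surjective' _ Ideal.Quotient.mk_surjective, Ideal.mk_ker, sup_comm] at hsa

/-- If the irrelevant maximal ideal of `Gr_K` has height at most `l.length`, then a regular sequence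
of initial forms of `l` generates an ideal containing a power of `K`. -/
theorem FilRegSeq.exists_pow_le {K : Ideal B} (hK : K ≤ maximalIdeal B) {l : List B}
    (h : FilRegSeq K ⊥ l)
    (hht : ((reesMax K (maximalIdeal B)).map (Ideal.Quotient.mk (reesQuot K ⊥))).height ≤
      l.length) : ∃ N, K ^ N ≤ Ideal.ofList l := by
  obtain ⟨L, hLl, hreg, hsup⟩ := h.exists_lift
  rw [bot_sup_eq] at hsup
  have hMmax : (reesMax K (maximalIdeal B)).IsMaximal := reesMax_isMaximal K _
  have hlen : L.length = l.length := by simpa using congrArg List.length hLl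
  have hLM : ∀ ξ ∈ L, ξ ∈ reesMax K (maximalIdeal B) := by
    intro ξ hξ
    obtain ⟨x, -, hx⟩ := exists_val_eq_of_map_val_eq hLl ξ hξ
    rw [mem_reesMax, hx, coeff_monomial, if_neg one_ne_zero]
    exact zero_mem _
  obtain ⟨t, ht⟩ := hreg.exists_pow_le_of_height_le (reesQuot_le_reesMax hK bot_le) hLM
    (by rwa [hlen])
  refine ⟨t, ?_⟩
  -- In degree t the multiplier f acts through its constant coefficient, a unit as f lies outside
  -- `reesMax`. Nakayama then removes the term K · Kᵗ.
  have key : K ^ t ≤ Ideal.ofList l ⊔ K • K ^ t := by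
    intro a ha
    obtain ⟨f, hf, hsa⟩ := ht (reesMonomial K t a ha) <|
      Ideal.pow_right_mono (fun f hf => by
        rw [mem_reesMax] at hf ⊢
        rw [Ideal.mem_bot.1 hf]
        exact zero_mem _) t (reesMonomial_mem_pow K le_rfl a ha)
    rw [hsup] at hsa
    have h3 := hsa (0 + t)
    rw [MulMemClass.coe_mul, reesMonomial_val, coeff_mul_monomial, zero_add] at h3
    rw [mem_reesMax, mem_maximalIdeal, mem_nonunits_iff, not_not] at hf
    rw [smul_eq_mul, ← pow_succ', sup_comm]
    exact (Ideal.unit_mul_mem_iff_mem _ hf).1 h3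
  refine Submodule.le_of_le_smul_of_le_jacobson_bot (IsNoetherian.noetherian _) ?_ key
  exact hK.trans (maximalIdeal_le_jacobson _)

theorem FilRegSeq.ringKrullDim_eq {K : Ideal B} (hK : K ≤ maximalIdeal B) {s : ℕ}
    (hs : maximalIdeal B ^ s ≤ K) {l : List B} (h : FilRegSeq K ⊥ l) {N : ℕ}
    (hN : K ^ N ≤ Ideal.ofList l) : ringKrullDim B = l.length := by
  have hK' : K ≠ ⊤ := fun h => (maximalIdeal.isMaximal B).ne_top (top_le_iff.1 (h ▸ hK))
  obtain ⟨hreg, hdim⟩ := (h.regSeqMod hK').length_le_ringKrullDim fun x hx => hK (h.mem x hx)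
  have : Nontrivial (B ⧸ Ideal.ofList l) :=
    Ideal.Quotient.nontrivial_iff.2 fun h => hreg.top_ne_smul (by simp [h])
  have : IsArtinianRing (B ⧸ Ideal.ofList l) := isArtinianRing_quotient (t := s * N) (by
    rw [pow_mul]; exact (Ideal.pow_right_mono hs N).trans hN)
  rw [← hdim, ringKrullDimZero_iff_ringKrullDim_eq_zero.1 inferInstance, zero_add]

end RelHilbert

/-! ### Extension of the residue field -/

namespace RelHilbert

open Polynomial IsLocalRing

section ResidueExtension

universe u
variable (B : Type u) [CommRing B] [IsLocalRing B]

instance isPrime_map_C_maximalIdeal : ((maximalIdeal B).map (C : B →+* B[X])).IsPrime :=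
  Ideal.isPrime_map_C_of_isPrime

/-- The local ring `B(T)`, with infinite residue field. -/
abbrev ResidueExtension : Type u :=
  Localization.AtPrime ((maximalIdeal B).map (C : B →+* B[X]))

theorem residueExtension_flat : Module.Flat B (ResidueExtension B) :=
  have : Module.Flat B[X] (ResidueExtension B) :=
    IsLocalization.flat _ ((maximalIdeal B).map (C : B →+* B[X])).primeCompl
  Module.Flat.trans B B[X] _

theorem residueExtension_isNoetherianRing [IsNoetherianRing B] :
    IsNoetherianRing (ResidueExtension B) :=
  IsLocalization.isNoetherianRing ((maximalIdeal B).map (C : B →+* B[X])).primeCompl _ inferInstance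

theorem map_maximalIdeal_residueExtension :
    (maximalIdeal B).map (algebraMap B (ResidueExtension B)) =
      maximalIdeal (ResidueExtension B) := by
  rw [← Localization.AtPrime.map_eq_maximalIdeal, IsScalarTower.algebraMap_eq B B[X],
    ← Ideal.map_map]
  rfl

theorem residueExtension_isLocalHom : IsLocalHom (algebraMap B (ResidueExtension B)) :=
  ((local_hom_TFAE (algebraMap B (ResidueExtension B))).out 0 2).2
    (map_maximalIdeal_residueExtension B).le

/-- The powers of T have distinct residues: for i ≠ j, Xⁱ − Xʲ has a unit coefficient. -/
theorem residueExtension_infinite : Infinite (ResidueField (ResidueExtension B)) := by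
  refine Infinite.of_injective
    (fun n : ℕ => residue (ResidueExtension B) (algebraMap B[X] _ (X ^ n))) fun i j hij => ?_
  have h1 : algebraMap B[X] (ResidueExtension B) (X ^ i - X ^ j) ∈ maximalIdeal _ := by
    rw [← residue_eq_zero_iff, map_sub, map_sub]
    exact sub_eq_zero.2 hij
  rw [IsLocalization.AtPrime.to_map_mem_maximal_iff (ResidueExtension B)
    ((maximalIdeal B).map (C : B →+* B[X])), Ideal.mem_map_C_iff] at h1
  by_contra hne
  have := h1 i
  rw [coeff_sub, coeff_X_pow_self, coeff_X_pow, if_neg hne, sub_zero] at this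
  exact (maximalIdeal.isMaximal B).ne_top ((Ideal.eq_top_iff_one _).2 this)

end ResidueExtension

/-! ### Length and dimension when the maximal ideal extends to the maximal ideal. -/

section FlatLocal

variable {B : Type*} [CommRing B] [IsLocalRing B] (B' : Type*) [CommRing B'] [IsLocalRing B']
  [Algebra B B'] [Module.Flat B B'] [IsLocalHom (algebraMap B B')]

theorem idealLength_map (h : (maximalIdeal B).map (algebraMap B B') = maximalIdeal B')
    (𝔟 : Ideal B) : idealLength (𝔟.map (algebraMap B B')) = idealLength 𝔟 := by
  rw [idealLength, (Algebra.TensorProduct.quotIdealMapEquivTensorQuot B' 𝔟).toLinearEquiv.length_eq,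
    IsLocalRing.length_baseChange, h]
  have : Module.length B' (B' ⧸ maximalIdeal B') = 1 := by
    have : IsSimpleModule B' (B' ⧸ maximalIdeal B') :=
      isSimpleModule_iff_isCoatom.2 (maximalIdeal.isMaximal B').out
    exact Module.length_eq_one B' _
  rw [this, mul_one, idealLength]

theorem ringKrullDim_eq_of_map_maximalIdeal [IsNoetherianRing B] [IsNoetherianRing B']
    (h : (maximalIdeal B).map (algebraMap B B') = maximalIdeal B') :
    ringKrullDim B' = ringKrullDim B := by
  have hl : (maximalIdeal B').LiesOver (maximalIdeal B) := inferInstance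
  have h1 := Ideal.height_eq_height_add_of_liesOver_of_hasGoingDown (maximalIdeal B) (maximalIdeal B')
  have h2 : (maximalIdeal B').map
      (Ideal.Quotient.mk ((maximalIdeal B).map (algebraMap B B'))) = ⊥ := by
    rw [Ideal.map_eq_bot_iff_le_ker, Ideal.mk_ker, h]
  have : Nontrivial (B' ⧸ (maximalIdeal B).map (algebraMap B B')) := by
    rw [h]; infer_instance
  rw [h2, Ideal.height_bot, add_zero] at h1
  rw [← maximalIdeal_height_eq_ringKrullDim, ← maximalIdeal_height_eq_ringKrullDim, h1]

end FlatLocal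

theorem height_le_height_of_flat {R S : Type*} [CommRing R] [CommRing S] [Algebra R S]
    [Module.Flat R S] [IsNoetherianRing R] [IsNoetherianRing S] (p : Ideal R) [p.IsPrime]
    (P : Ideal S) [P.IsPrime] [P.LiesOver p] : p.height ≤ P.height := by
  rw [Ideal.height_eq_height_add_of_liesOver_of_hasGoingDown p P]
  exact le_self_add

end RelHilbert

/-! ### Leading forms -/

namespace RelHilbert

open Polynomial IsLocalRing

section LeadingForms

variable {B : Type*} [CommRing B] {J : Ideal B}

theorem coeff_mul_reesMonomial (f : reesAlgebra J) {n : ℕ} {b : B} (hb : b ∈ J ^ n) (k : ℕ) :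
    ((f * reesMonomial J n b hb : reesAlgebra J) : B[X]).coeff (k + n) = (f : B[X]).coeff k * b := by
  rw [MulMemClass.coe_mul, reesMonomial_val, coeff_mul_monomial]

/-- The ideal of the Rees algebra generated by the leading forms of the elements of `𝔮`. -/
noncomputable def leadIdeal (𝔮 : Ideal (reesAlgebra J)) : Ideal (reesAlgebra J) where
  carrier := {g | ∀ n, ∃ f ∈ 𝔮, (f : B[X]).coeff n = (g : B[X]).coeff n ∧
    ∀ m > n, (f : B[X]).coeff m = 0}
  zero_mem' n := ⟨0, zero_mem _, rfl, fun _ _ => coeff_zero _⟩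
  add_mem' := by
    intro g g' hg hg' n
    obtain ⟨f, hf, hfn, hf0⟩ := hg n
    obtain ⟨f', hf', hfn', hf0'⟩ := hg' n
    exact ⟨f + f', add_mem hf hf', by simp [hfn, hfn'],
      fun m hm => by simp [hf0 m hm, hf0' m hm]⟩
  smul_mem' := by
    intro h g hg n
    choose f hf hfn hf0 using hg
    refine ⟨∑ p ∈ Finset.HasAntidiagonal.antidiagonal n,
      f p.2 * reesMonomial J p.1 ((h : B[X]).coeff p.1) (h.2 p.1),
      sum_mem fun p _ => Ideal.mul_mem_right _ _ (hf p.2), ?_, fun m hm => ?_⟩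
    · rw [AddSubmonoidClass.coe_finsetSum, finsetSum_coeff, smul_eq_mul, MulMemClass.coe_mul,
        coeff_mul]
      refine Finset.sum_congr rfl fun p hp => ?_
      rw [Finset.HasAntidiagonal.mem_antidiagonal] at hp
      rw [← hp, add_comm, coeff_mul_reesMonomial, hfn, mul_comm]
    · rw [AddSubmonoidClass.coe_finsetSum, finsetSum_coeff]
      refine Finset.sum_eq_zero fun p hp => ?_
      rw [Finset.HasAntidiagonal.mem_antidiagonal] at hp
      obtain ⟨k, rfl⟩ : ∃ k, m = k + p.1 := ⟨m - p.1, by omega⟩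
      rw [coeff_mul_reesMonomial, hf0 p.2 k (by omega), zero_mul]

theorem reesMonomial_mem_leadIdeal {𝔮 : Ideal (reesAlgebra J)} {n : ℕ} {b : B} {hb : b ∈ J ^ n} :
    reesMonomial J n b hb ∈ leadIdeal 𝔮 ↔ ∃ f ∈ 𝔮, (f : B[X]).coeff n = b ∧
      ∀ m > n, (f : B[X]).coeff m = 0 := by
  constructor
  · intro h
    simpa using h n
  · rintro ⟨f, hf, hfn, hf0⟩ m
    rcases eq_or_ne n m with rfl | hnm
    · exact ⟨f, hf, by simpa using hfn, hf0⟩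
    · exact ⟨0, zero_mem _, by simp [coeff_monomial, hnm], fun _ _ => coeff_zero _⟩

theorem leadIdeal_reesQuot (𝔠 : Ideal B) : leadIdeal (reesQuot J 𝔠) = reesQuot J 𝔠 := by
  ext g
  constructor
  · intro hg n
    obtain ⟨f, hf, hfn, -⟩ := hg n
    exact hfn ▸ hf n
  · intro hg n
    exact ⟨reesMonomial J n _ (g.2 n), reesMonomial_mem_reesQuot.2 (hg n), by simp,
      fun m hm => by simp [coeff_monomial, hm.ne]⟩

theorem coeff_mul_of_coeff_eq_zero {f g : B[X]} {e n : ℕ} (hf : ∀ m > e, f.coeff m = 0)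
    (hg : ∀ m > n, g.coeff m = 0) :
    (f * g).coeff (e + n) = f.coeff e * g.coeff n ∧ ∀ m > e + n, (f * g).coeff m = 0 := by
  have h : f.natDegree ≤ e := natDegree_le_iff_coeff_eq_zero.2 fun m hm => hf m hm
  have h' : g.natDegree ≤ n := natDegree_le_iff_coeff_eq_zero.2 fun m hm => hg m hm
  exact ⟨coeff_mul_add_eq_of_natDegree_le h h',
    fun m hm => natDegree_le_iff_coeff_eq_zero.1 (natDegree_mul_le_of_le h h') m hm⟩

/-- If fg ∈ 𝔮, regularity of the leading form makes the top term of g that of an element of 𝔮;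
subtracting this element lowers the degree. -/
theorem isRegMod_of_isRegMod_leadIdeal {𝔮 : Ideal (reesAlgebra J)} {e : ℕ} {y : B} {hy : y ∈ J ^ e}
    (h : IsRegMod (leadIdeal 𝔮) (reesMonomial J e y hy)) {f : reesAlgebra J}
    (hfe : (f : B[X]).coeff e = y) (hf0 : ∀ m > e, (f : B[X]).coeff m = 0) : IsRegMod 𝔮 f := by
  have key : ∀ n : ℕ, ∀ g : reesAlgebra J, (∀ m ≥ n, (g : B[X]).coeff m = 0) → f * g ∈ 𝔮 → g ∈ 𝔮 := by
    intro n
    induction n with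
    | zero =>
      intro g hg _
      have : g = 0 := Subtype.ext (Polynomial.ext fun m => hg m (Nat.zero_le m))
      rw [this]
      exact zero_mem _
    | succ n ih =>
      intro g hg hfg
      obtain ⟨h1, h2⟩ := coeff_mul_of_coeff_eq_zero hf0 (n := n) (fun m hm => hg m hm)
      obtain ⟨g', hg', hgn, hg0⟩ := reesMonomial_mem_leadIdeal.1 <| h (reesMonomial J n _ (g.2 n)) <| by
        rw [reesMonomial_mul J hy (g.2 n)]
        exact reesMonomial_mem_leadIdeal.2 ⟨f * g, hfg, by rw [MulMemClass.coe_mul, h1, hfe],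
          fun m hm => h2 m hm⟩
      have := ih (g - g') (fun m hm => by
        rw [AddSubgroupClass.coe_sub, coeff_sub]
        rcases hm.eq_or_lt with rfl | hm
        · rw [hgn, sub_self]
        · rw [hg m hm, hg0 m hm, sub_zero]) (by
        rw [mul_sub]
        exact sub_mem hfg (𝔮.mul_mem_left _ hg'))
      simpa using add_mem this hg'
  intro g hg
  refine key ((g : B[X]).natDegree + 1) g (fun m hm => ?_) hg
  exact coeff_eq_zero_of_natDegree_lt hm

/-- When the top of fg cancels against q, regularity lets g be changed modulo 𝔮 to lower its degree,
until no cancellation remains. -/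
theorem leadIdeal_sup_span {𝔮 : Ideal (reesAlgebra J)} {e : ℕ} {y : B} {hy : y ∈ J ^ e}
    (h : IsRegMod (leadIdeal 𝔮) (reesMonomial J e y hy)) {f : reesAlgebra J}
    (hfe : (f : B[X]).coeff e = y) (hf0 : ∀ m > e, (f : B[X]).coeff m = 0) :
    leadIdeal (𝔮 ⊔ Ideal.span {f}) = leadIdeal 𝔮 ⊔ Ideal.span {reesMonomial J e y hy} := by
  apply le_antisymm
  · have key : ∀ n k : ℕ, ∀ q ∈ 𝔮, ∀ g : reesAlgebra J, (∀ m ≥ k, (g : B[X]).coeff m = 0) →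
        (∀ m > n, ((q + f * g : reesAlgebra J) : B[X]).coeff m = 0) →
        reesMonomial J n (((q + f * g : reesAlgebra J) : B[X]).coeff n) ((q + f * g).2 n) ∈
          leadIdeal 𝔮 ⊔ Ideal.span {reesMonomial J e y hy} := by
      intro n k
      induction k with
      | zero =>
        intro q hq g hg h0
        have hg : g = 0 := Subtype.ext (Polynomial.ext fun m => hg m (Nat.zero_le m))
        subst hg
        refine Ideal.mem_sup_left (reesMonomial_mem_leadIdeal.2 ⟨q, hq, by simp, fun m hm => ?_⟩)
        simpa using h0 m hm
      | succ k ih =>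
        intro q hq g hg h0
        obtain ⟨h1, h2⟩ := coeff_mul_of_coeff_eq_zero hf0 (n := k) (fun m hm => hg m hm)
        rcases le_or_gt (e + k) n with hle | hlt
        · have hq0 : ∀ m > n, (q : B[X]).coeff m = 0 := fun m hm => by
            have := h0 m hm
            rw [AddMemClass.coe_add, coeff_add, MulMemClass.coe_mul, h2 m (by omega), add_zero] at this
            exact this
          rw [mem_sup_span_singleton]
          refine ⟨reesMonomial J n _ (q.2 n),
            reesMonomial_mem_leadIdeal.2 ⟨q, hq, rfl, hq0⟩, ?_⟩
          rcases hle.eq_or_lt with rfl | hlt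
          · refine ⟨reesMonomial J k _ (g.2 k), ?_⟩
            rw [reesMonomial_mul J hy (g.2 k)]
            apply Subtype.ext
            change monomial (e + k) ((q : B[X]) + f * g |>.coeff (e + k)) =
              monomial (e + k) ((q : B[X]).coeff (e + k)) + monomial (e + k) (y * (g : B[X]).coeff k)
            rw [coeff_add, h1, hfe, map_add]
          · refine ⟨0, ?_⟩
            apply Subtype.ext
            rw [mul_zero, add_zero]
            change monomial n ((q : B[X]) + f * g |>.coeff n) = monomial n ((q : B[X]).coeff n)
            rw [coeff_add, h2 n hlt, add_zero]
        · obtain ⟨g', hg', hgn, hg0⟩ := reesMonomial_mem_leadIdeal.1 <|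
              h (reesMonomial J k _ (g.2 k)) <| by
            rw [reesMonomial_mul J hy (g.2 k)]
            refine reesMonomial_mem_leadIdeal.2 ⟨-q, neg_mem hq, ?_, fun m hm => ?_⟩
            · have := h0 (e + k) hlt
              rw [AddMemClass.coe_add, coeff_add, MulMemClass.coe_mul, h1, hfe] at this
              rw [NegMemClass.coe_neg, coeff_neg]
              linear_combination -this
            · have := h0 m (by omega)
              rw [AddMemClass.coe_add, coeff_add, MulMemClass.coe_mul, h2 m hm, add_zero] at this
              rw [NegMemClass.coe_neg, coeff_neg, this, neg_zero]
          have hrw : q + f * g = (q + f * g') + f * (g - g') := by ring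
          have := ih (q + f * g') (add_mem hq (𝔮.mul_mem_left _ hg')) (g - g') (fun m hm => by
            rw [AddSubgroupClass.coe_sub, coeff_sub]
            rcases hm.eq_or_lt with rfl | hm
            · rw [hgn, sub_self]
            · rw [hg m hm, hg0 m hm, sub_zero]) (by rwa [← hrw])
          simpa only [← hrw] using this
    intro u hu
    refine mem_of_forall_reesMonomial _ u fun n => ?_
    obtain ⟨v, hv, hvn, hv0⟩ := hu n
    obtain ⟨q, hq, g, rfl⟩ := mem_sup_span_singleton.1 hv
    have := key n ((g : B[X]).natDegree + 1) q hq g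
      (fun m hm => coeff_eq_zero_of_natDegree_lt hm) hv0
    simpa only [hvn] using this
  · refine sup_le (fun g hg n => ?_) ?_
    · obtain ⟨q, hq, hqn⟩ := hg n
      exact ⟨q, Ideal.mem_sup_left hq, hqn⟩
    · rw [Ideal.span_singleton_le_iff_mem]
      exact reesMonomial_mem_leadIdeal.2
        ⟨f, Ideal.mem_sup_right (Ideal.mem_span_singleton_self f), hfe, hf0⟩

/-- If the elements of `L` form a regular sequence modulo the leading forms of `𝔮` and `𝔭` contains
polynomials with leading forms powers of the members of `L`, then `𝔭` contains a regular
sequence modulo `𝔮` of the same length. -/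
theorem gradeGE_of_leadIdeal {L : List (reesAlgebra J)} {𝔭 𝔮 : Ideal (reesAlgebra J)}
    (hL : RegSeqMod (leadIdeal 𝔮) L)
    (h : ∀ ξ ∈ L, ∃ (e : ℕ) (y : B) (hy : y ∈ J ^ e), ∃ f ∈ 𝔭, ∃ k : ℕ, reesMonomial J e y hy = ξ ^ k ∧
      (f : B[X]).coeff e = y ∧ ∀ m > e, (f : B[X]).coeff m = 0) :
    GradeGE 𝔭 𝔮 L.length := by
  induction L generalizing 𝔮 with
  | nil => exact gradeGE_zero _ _
  | cons ξ L ih =>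
    obtain ⟨e, y, hy, f, hf, k, hk, hfe, hf0⟩ := h ξ List.mem_cons_self
    have hreg : IsRegMod (leadIdeal 𝔮) (reesMonomial J e y hy) := hk ▸ hL.1.pow k
    refine gradeGE_succ.2 ⟨f, hf, isRegMod_of_isRegMod_leadIdeal hreg hfe hf0,
      ih ?_ fun ζ hζ => h ζ (List.mem_cons_of_mem _ hζ)⟩
    rw [leadIdeal_sup_span hreg hfe hf0, hk]
    exact RegSeqMod.sup_pow hL.1 hL.2 k

theorem coeff_aeval_of_val_eq_monomial {ξ : reesAlgebra J} {x : B} (hξ : (ξ : B[X]) = monomial 1 x)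
    (p : B[X]) (n : ℕ) : ((aeval ξ p : reesAlgebra J) : B[X]).coeff n = p.coeff n * x ^ n := by
  have : ((aeval ξ p : reesAlgebra J) : B[X]) = p.comp (C x * X) := by
    change (reesAlgebra J).val (aeval ξ p) = _
    rw [← aeval_algHom_apply, Subalgebra.coe_val, hξ, C_mul_X_eq_monomial]
    rfl
  rw [this, comp_C_mul_X_coeff]

end LeadingForms

end RelHilbert

/-! ### Integrality over the base and heights -/

namespace RelHilbert

open Polynomial IsLocalRing

section Integrality

/-- If `J` has a power in `(l)`, then a quotient of `Gr_J` in which the degree one forms attached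
to `l` are integral over `B` is itself integral over `B`. -/
theorem isIntegral_of_reesQuot_le_ker {B : Type*} [CommRing B]
    [IsNoetherianRing B] {J : Ideal B} {N : ℕ}
    {l : List B} {L : List (reesAlgebra J)} (hL : L.map Subtype.val = l.map (monomial 1))
    (hsup : reesQuot J ⊥ ⊔ Ideal.ofList L = reesQuot J (Ideal.ofList l))
    (hN : J ^ N ≤ Ideal.ofList l) {S : Type*} [CommRing S] [Algebra B S]
    {Φ : reesAlgebra J →ₐ[B] S} (hΦ : Function.Surjective Φ) (hQ : ∀ f ∈ reesQuot J ⊥, Φ f = 0)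
    (hint : ∀ ξ ∈ L, IsIntegral B (Φ ξ)) : Algebra.IsIntegral B S := by
  let S₀ := integralClosure B S
  let φ (n : ℕ) : ↥(J ^ n) →ₗ[B] S := Φ.toLinearMap ∘ₗ
    { toFun := fun b => reesMonomial J n b b.2
      map_add' := fun a b => reesMonomial_add J n a.2 b.2 (a + b).2
      map_smul' := fun a b => by
        rw [RingHom.id_apply, Algebra.smul_def,
          ← reesMonomial_algebraMap_mul J n a b.2 (Ideal.mul_mem_left _ _ b.2)]
        rfl }
  let T : Submodule B S := ⨆ n : Fin (N + 1), LinearMap.range (φ n)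
  have hT : T.FG := Submodule.fg_iSup _ fun n => by
    rw [← Submodule.map_top]
    exact (IsNoetherian.noetherian (⊤ : Submodule B ↥(J ^ (n : ℕ)))).map _
  obtain ⟨F, hF⟩ := hT
  -- The S₀-span of the images of degrees at most N. Once it is all of S, S is finite over S₀ and
  -- hence integral over B.
  let W : Submodule S₀ S := Submodule.span S₀ F
  have hTW : ∀ t ∈ T, t ∈ W := by
    intro t ht
    rw [← hF] at ht
    exact Submodule.span_le_restrictScalars B S₀ (F : Set S) ht
  let π (n : ℕ) : reesAlgebra J →+ reesAlgebra J :=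
    AddMonoidHom.mk' (fun f => reesMonomial J n ((f : B[X]).coeff n) (f.2 n)) fun f g =>
      Subtype.ext ((congrArg (monomial n) (coeff_add _ _ _)).trans (map_add _ _ _))
  have hW : ∀ n b (hb : b ∈ J ^ n), Φ (reesMonomial J n b hb) ∈ W := by
    intro n
    induction n with
    | zero => exact fun b hb => hTW _ (Submodule.mem_iSup_of_mem 0 ⟨⟨b, hb⟩, rfl⟩)
    | succ n ih =>
      intro b hb
      rcases lt_or_ge (n + 1) (N + 1) with hlt | hge
      · exact hTW _ (Submodule.mem_iSup_of_mem ⟨n + 1, hlt⟩ ⟨⟨b, hb⟩, rfl⟩)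
      · have hmem : reesMonomial J (n + 1) b hb ∈ reesQuot J ⊥ ⊔ Ideal.ofList L := by
          rw [hsup]
          exact reesMonomial_mem_reesQuot.2
            (Ideal.mem_sup_right (hN (Ideal.pow_le_pow_right (by omega) hb)))
        obtain ⟨q, hq, g, hg, hqg⟩ := Submodule.mem_sup.1 hmem
        have key : ∀ g ∈ Ideal.ofList L, Φ (π (n + 1) g) ∈ W := by
          intro g hg
          refine Submodule.closure_induction (p := fun g _ => Φ (π (n + 1) g) ∈ W)
            ?_ ?_ ?_ hg
          · rw [map_zero, map_zero]
            exact zero_mem _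
          · intro f f' _ _ hf hf'
            rw [map_add, map_add]
            exact add_mem hf hf'
          · intro r ξ hξ
            obtain ⟨x, -, hx⟩ := exists_val_eq_of_map_val_eq hL ξ hξ
            have h1 : π (n + 1) (r • ξ) = ξ * reesMonomial J n ((r : B[X]).coeff n) (r.2 n) := by
              apply Subtype.ext
              change monomial (n + 1) (((r : B[X]) * (ξ : B[X])).coeff (n + 1)) =
                (ξ : B[X]) * monomial n ((r : B[X]).coeff n)
              rw [hx, coeff_mul_monomial, monomial_mul_monomial, add_comm, mul_comm]
            rw [h1, map_mul]
            exact W.smul_mem (⟨_, hint ξ hξ⟩ : S₀) (ih _ (r.2 n))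
        have h2 : reesMonomial J (n + 1) b hb = π (n + 1) q + π (n + 1) g := by
          rw [← map_add, hqg]
          exact Subtype.ext (congrArg (monomial (n + 1)) (by simp))
        rw [h2, map_add]
        refine add_mem ?_ (key g hg)
        have h3 : Φ (π (n + 1) q) = 0 :=
          hQ _ (reesMonomial_mem_reesQuot (hb := q.2 (n + 1)).2 (hq (n + 1)))
        rw [h3]
        exact zero_mem _
  have htop : W = ⊤ := by
    refine eq_top_iff.2 fun t _ => ?_
    obtain ⟨f, rfl⟩ := hΦ t
    exact mem_of_forall_reesMonomial (W.toAddSubmonoid.comap (Φ : reesAlgebra J →+ S)) f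
      fun n => hW n _ (f.2 n)
  have hfin : Module.Finite S₀ S := ⟨⟨F, htop⟩⟩
  exact Algebra.IsIntegral.trans S₀

variable {B : Type*} [CommRing B] [IsLocalRing B]

theorem comap_eq_maximalIdeal_of_prime {S : Type*} [CommRing S] [Algebra B S] {J : Ideal B} {s : ℕ}
    (hs : maximalIdeal B ^ s ≤ J) (𝔭 : Ideal S) [𝔭.IsPrime] (h : J ≤ 𝔭.comap (algebraMap B S)) :
    𝔭.comap (algebraMap B S) = maximalIdeal B :=
  ((maximalIdeal.isMaximal B).eq_of_le (Ideal.IsPrime.ne_top inferInstance)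
    (Ideal.IsPrime.le_of_pow_le (hs.trans h))).symm

/-- A residue field of a finitely generated algebra at a maximal ideal over the maximal ideal of
the base is algebraic over the base. -/
theorem isIntegral_quotient_of_isMaximal {S : Type*} [CommRing S] [Algebra B S]
    [Algebra.FiniteType B S] (P : Ideal S) [hP : P.IsMaximal]
    (h : P.comap (algebraMap B S) = maximalIdeal B) : Algebra.IsIntegral B (S ⧸ P) := by
  have : (P.comap (algebraMap B S)).IsMaximal := h ▸ maximalIdeal.isMaximal B
  let _ := Ideal.Quotient.field P
  let _ := Ideal.Quotient.field (P.comap (algebraMap B S))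
  have : Algebra.FiniteType B (S ⧸ P) :=
    Algebra.FiniteType.of_surjective (Ideal.Quotient.mkₐ B P) (Ideal.Quotient.mkₐ_surjective B P)
  have : IsScalarTower B (B ⧸ P.comap (algebraMap B S)) (S ⧸ P) :=
    IsScalarTower.of_algebraMap_eq fun _ => rfl
  have : Algebra.FiniteType (B ⧸ P.comap (algebraMap B S)) (S ⧸ P) :=
    Algebra.FiniteType.of_restrictScalars_finiteType B _ _
  have : Module.Finite (B ⧸ P.comap (algebraMap B S)) (S ⧸ P) :=
    finite_of_finite_type_of_isJacobsonRing _ _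
  have : Algebra.IsIntegral B (B ⧸ P.comap (algebraMap B S)) :=
    Algebra.IsIntegral.of_surjective (Ideal.Quotient.mkₐ B _) (Ideal.Quotient.mkₐ_surjective B _)
  exact Algebra.IsIntegral.trans (B ⧸ P.comap (algebraMap B S))

theorem isMaximal_of_isIntegral_quotient {S : Type*} [CommRing S] [Algebra B S] {𝔭 : Ideal S}
    [𝔭.IsPrime] [Algebra.IsIntegral B (S ⧸ 𝔭)]
    (h : 𝔭.comap (algebraMap B S) = maximalIdeal B) : 𝔭.IsMaximal := by
  rw [← Ideal.bot_quotient_isMaximal_iff]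
  refine Ideal.isMaximal_of_isIntegral_of_isMaximal_comap (R := B) (⊥ : Ideal (S ⧸ 𝔭)) ?_
  have h4 : (⊥ : Ideal (S ⧸ 𝔭)).comap (algebraMap B (S ⧸ 𝔭)) = 𝔭.comap (algebraMap B S) := by
    ext b
    rw [Ideal.mem_comap, Ideal.mem_comap, Ideal.mem_bot, ← Ideal.Quotient.eq_zero_iff_mem]
    rfl
  rw [h4, h]
  exact maximalIdeal.isMaximal B

/-- If `J` has a power in `(l)` and the degree one forms attached to `l` are integral modulo a prime
containing the irrelevant part, then that prime is maximal. -/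
theorem isMaximal_of_isIntegral_of_reesQuot [IsNoetherianRing B] {J : Ideal B} {s N : ℕ}
    (hs : maximalIdeal B ^ s ≤ J)
    {l : List B} {L : List (reesAlgebra J)} (hL : L.map Subtype.val = l.map (monomial 1))
    (hsup : reesQuot J ⊥ ⊔ Ideal.ofList L = reesQuot J (Ideal.ofList l))
    (hN : J ^ N ≤ Ideal.ofList l) (𝔭 : Ideal (reesAlgebra J)) [𝔭.IsPrime] (h𝔭 : reesQuot J ⊥ ≤ 𝔭)
    (hint : ∀ ξ ∈ L, IsIntegral B (Ideal.Quotient.mk 𝔭 ξ)) : 𝔭.IsMaximal := by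
  have : Algebra.IsIntegral B (reesAlgebra J ⧸ 𝔭) :=
    isIntegral_of_reesQuot_le_ker hL hsup hN (S := reesAlgebra J ⧸ 𝔭) (Φ := Ideal.Quotient.mkₐ B 𝔭)
    (Ideal.Quotient.mkₐ_surjective B 𝔭) (fun f hf => Ideal.Quotient.eq_zero_iff_mem.2 (h𝔭 hf)) hint
  refine isMaximal_of_isIntegral_quotient (comap_eq_maximalIdeal_of_prime hs 𝔭 fun b hb => h𝔭 ?_)
  rw [reesQuot_bot]
  exact Ideal.mem_map_of_mem _ hb

end Integrality

/-! ### Height bounds from regular sequences and from Krull's theorem. -/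

section Heights

variable {R : Type*} [CommRing R] [IsNoetherianRing R]

theorem GradeGE.le_height {Q M : Ideal R} [hM : M.IsMaximal] (hQM : Q ≤ M) {d : ℕ}
    (h : GradeGE M Q d) : (d : ℕ∞) ≤ (M.map (Ideal.Quotient.mk Q)).height := by
  have hcomap : (M.map (Ideal.Quotient.mk Q)).comap (Ideal.Quotient.mk Q) = M := by
    rw [Ideal.comap_map_of_surjective' _ Ideal.Quotient.mk_surjective, Ideal.mk_ker,
      sup_eq_left.2 hQM]
  have hmax : (M.map (Ideal.Quotient.mk Q)).IsMaximal := by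
    refine (Ideal.map_eq_top_or_isMaximal_of_surjective _ Ideal.Quotient.mk_surjective
      hM).resolve_left fun htop => hM.ne_top ?_
    rw [← hcomap, htop, Ideal.comap_top]
  have h1 : GradeGE (M.map (Ideal.Quotient.mk Q)) ⊥ d := by
    refine GradeGE.of_comap_of_surjective (f := Ideal.Quotient.mk Q)
      Ideal.Quotient.mk_surjective ?_
    rwa [← RingHom.ker_eq_comap_bot, Ideal.mk_ker, hcomap]
  have := IsLocalization.isNoetherianRing (M.map (Ideal.Quotient.mk Q)).primeCompl
    (Localization.AtPrime (M.map (Ideal.Quotient.mk Q))) inferInstance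
  have h2 := (gradeGE_localization_iff.2 h1).le_ringKrullDim
  rw [IsLocalization.AtPrime.ringKrullDim_eq_height (M.map (Ideal.Quotient.mk Q))] at h2
  exact_mod_cast h2

/-- If every prime over `Q S + (F)` is maximal, then `M / Q` has height at most `|F|`. -/
theorem height_map_mk_le_card {S : Type*} [CommRing S] [IsNoetherianRing S] [Algebra R S]
    [Module.Flat R S] {Q M : Ideal R} [hM : M.IsMaximal] (hQM : Q ≤ M) {P : Ideal S} [hP : P.IsPrime]
    (hMP : M.map (algebraMap R S) ≤ P) (F : Finset S) (hF : ∀ f ∈ F, f ∈ P)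
    (hmax : ∀ 𝔭 : Ideal S, 𝔭.IsPrime → Q.map (algebraMap R S) ≤ 𝔭 → (∀ f ∈ F, f ∈ 𝔭) →
      𝔭.IsMaximal) : (M.map (Ideal.Quotient.mk Q)).height ≤ F.card := by
  classical
  let Q' := Q.map (algebraMap R S)
  have hflat : Module.Flat (R ⧸ Q) (S ⧸ Q') := flat_quotient_map Q
  have hQP : Q' ≤ P := (Ideal.map_mono hQM).trans hMP
  have hcM : (M.map (Ideal.Quotient.mk Q)).comap (Ideal.Quotient.mk Q) = M := by
    rw [Ideal.comap_map_of_surjective' _ Ideal.Quotient.mk_surjective, Ideal.mk_ker,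
      sup_eq_left.2 hQM]
  have hcP : (P.map (Ideal.Quotient.mk Q')).comap (Ideal.Quotient.mk Q') = P := by
    rw [Ideal.comap_map_of_surjective' _ Ideal.Quotient.mk_surjective, Ideal.mk_ker,
      sup_eq_left.2 hQP]
  have hMmax : (M.map (Ideal.Quotient.mk Q)).IsMaximal := by
    refine (Ideal.map_eq_top_or_isMaximal_of_surjective _ Ideal.Quotient.mk_surjective
      hM).resolve_left fun htop => hM.ne_top ?_
    rw [← hcM, htop, Ideal.comap_top]
  have hPpr : (P.map (Ideal.Quotient.mk Q')).IsPrime :=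
    Ideal.map_isPrime_of_surjective Ideal.Quotient.mk_surjective (by rwa [Ideal.mk_ker])
  have hover : (P.map (Ideal.Quotient.mk Q')).LiesOver (M.map (Ideal.Quotient.mk Q)) := by
    refine ⟨hMmax.eq_of_le (Ideal.IsPrime.ne_top inferInstance) ?_⟩
    rw [Ideal.map_le_iff_le_comap]
    intro a ha
    change Ideal.Quotient.mk Q' (algebraMap R S a) ∈ P.map (Ideal.Quotient.mk Q')
    exact Ideal.mem_map_of_mem _ (hMP (Ideal.mem_map_of_mem _ ha))
  refine (height_le_height_of_flat (M.map (Ideal.Quotient.mk Q)) (P.map (Ideal.Quotient.mk Q'))).trans ?_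
  -- Any prime over F below P/Q' is maximal, hence equal to it. Krull's height theorem bounds its
  -- height, and going down has already bounded that of M/Q.
  have hmin : P.map (Ideal.Quotient.mk Q') ∈
      (Ideal.span (F.image (Ideal.Quotient.mk Q') : Finset (S ⧸ Q'))).minimalPrimes := by
    refine ⟨⟨hPpr, ?_⟩, ?_⟩
    · rw [Ideal.span_le, Finset.coe_image]
      rintro _ ⟨f, hf, rfl⟩
      exact Ideal.mem_map_of_mem _ (hF f hf)
    · rintro 𝔮 ⟨h𝔮, hF𝔮⟩ hle
      have h1 : (𝔮.comap (Ideal.Quotient.mk Q')).IsMaximal := by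
        refine hmax _ inferInstance ?_ fun f hf => ?_
        · have := Ideal.ker_le_comap (K := 𝔮) (Ideal.Quotient.mk Q')
          rwa [Ideal.mk_ker] at this
        · exact hF𝔮 (Ideal.subset_span (Finset.mem_coe.2 (Finset.mem_image_of_mem _ hf)))
      have h2 := h1.eq_of_le hP.ne_top (hcP ▸ Ideal.comap_mono hle)
      rw [Ideal.map_le_iff_le_comap, h2]
  refine (Ideal.height_le_card_of_mem_minimalPrimes_span_finset hmin).trans ?_
  exact_mod_cast Finset.card_image_le

end Heights

end RelHilbert

/-! ### Cohen-Macaulayness of the associated graded ring -/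

namespace RelHilbert

open Polynomial IsLocalRing

section AssociatedGraded

variable {B : Type*} [CommRing B]

theorem isIntegral_of_rees_baseChange {J : Ideal B} {B' : Type*} [CommRing B'] [Algebra B B']
    [Module.Flat B B'] {S : Type*} [CommRing S] [Algebra B' S]
    (Φ : reesAlgebra (J.map (algebraMap B B')) →ₐ[B'] S)
    (h : ∀ r : reesAlgebra J, IsIntegral B' (Φ (algebraMap _ _ r)))
    (f : reesAlgebra (J.map (algebraMap B B'))) : IsIntegral B' (Φ f) := by
  obtain ⟨e, he⟩ := exists_rees_baseChange B' J
  obtain ⟨t, rfl⟩ := e.surjective f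
  induction t with
  | zero => rw [map_zero, map_zero]; exact isIntegral_zero
  | add t t' h h' => rw [map_add, map_add]; exact h.add h'
  | tmul r b =>
    rw [he, map_mul, AlgHom.commutes]
    exact (h r).mul isIntegral_algebraMap

theorem isIntegral_quotient_map_rees {J : Ideal B} (B' : Type*) [CommRing B'] [Algebra B B']
    [Module.Flat B B'] (P : Ideal (reesAlgebra J)) [Algebra.IsIntegral B (reesAlgebra J ⧸ P)] :
    Algebra.IsIntegral B' (reesAlgebra (J.map (algebraMap B B')) ⧸
      P.map (algebraMap (reesAlgebra J) (reesAlgebra (J.map (algebraMap B B'))))) := by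
  let R' := reesAlgebra (J.map (algebraMap B B'))
  let 𝔓 := P.map (algebraMap (reesAlgebra J) R')
  have h1 : ∀ r : reesAlgebra J, IsIntegral B' (Ideal.Quotient.mk 𝔓 (algebraMap _ R' r)) := by
    intro r
    refine IsIntegral.map_of_comp_eq (algebraMap B B')
      (Ideal.quotientMap 𝔓 (algebraMap (reesAlgebra J) R') Ideal.le_comap_map) ?_
      (Algebra.IsIntegral.isIntegral (R := B) (Ideal.Quotient.mk P r))
    ext b
    change Ideal.Quotient.mk 𝔓 _ = Ideal.Quotient.mk 𝔓 _
    congr 1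
    have := isScalarTower_rees B' J
    exact (IsScalarTower.algebraMap_apply B (reesAlgebra J) R' b)
  refine ⟨fun x => ?_⟩
  obtain ⟨f, rfl⟩ := Ideal.Quotient.mk_surjective x
  exact isIntegral_of_rees_baseChange (S := R' ⧸ 𝔓) (Ideal.Quotient.mkₐ B' 𝔓) h1 f

/-- The associated graded ring of `J` is Cohen-Macaulay if, after a faithfully flat extension of
local rings, the initial forms of some sequence generating an ideal containing a power of `J` are
a regular sequence. -/
theorem isCohenMacaulayRing_associatedGraded [IsNoetherianRing B] [IsLocalRing B] {B' : Type*}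
    [CommRing B'] [IsNoetherianRing B'] [IsLocalRing B'] [Algebra B B'] [Module.FaithfullyFlat B B']
    (h : (maximalIdeal B).map (algebraMap B B') = maximalIdeal B') {J : Ideal B} {s N : ℕ}
    (hs : maximalIdeal B ^ s ≤ J) {l : List B'}
    (hl : FilRegSeq (J.map (algebraMap B B')) ⊥ l)
    (hN : J.map (algebraMap B B') ^ N ≤ Ideal.ofList l) :
    IsCohenMacaulayRing (AssociatedGraded J) := by
  classical
  let R' := reesAlgebra (J.map (algebraMap B B'))
  have hflat : Module.Flat (reesAlgebra J) R' := rees_flat B' J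
  have hff : Module.FaithfullyFlat (reesAlgebra J) R' := rees_faithfullyFlat B' J
  have hft : Algebra.FiniteType B (reesAlgebra J) :=
    (Subalgebra.fg_iff_finiteType _).1 (reesAlgebra.fg (IsNoetherian.noetherian J))
  change IsCohenMacaulayRing (reesAlgebra J ⧸ J.map (algebraMap B (reesAlgebra J)))
  rw [← reesQuot_bot, isCohenMacaulayRing_quotient_iff]
  intro P hP hQP
  have hcomap : P.comap (algebraMap B (reesAlgebra J)) = maximalIdeal B := by
    refine comap_eq_maximalIdeal_of_prime hs P fun b hb => hQP ?_
    rw [reesQuot_bot]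
    exact Ideal.mem_map_of_mem _ hb
  have := isIntegral_quotient_of_isMaximal P hcomap
  have hint := isIntegral_quotient_map_rees B' P
  let 𝔓 := P.map (algebraMap (reesAlgebra J) R')
  -- P may be nonhomogeneous and miss the initial forms, but residues modulo P are integral over B,
  -- and this survives base change.
  have hpoly : ∀ ξ : R', ∃ p : B'[X], p.Monic ∧ aeval ξ p ∈ 𝔓 := by
    intro ξ
    obtain ⟨p, hp, hp0⟩ := hint.isIntegral (Ideal.Quotient.mk 𝔓 ξ)
    refine ⟨p, hp, ?_⟩
    rw [← Ideal.Quotient.eq_zero_iff_mem, ← hp0]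
    exact (aeval_algHom_apply (Ideal.Quotient.mkₐ B' 𝔓) ξ p).symm
  choose p hp hpP using hpoly
  obtain ⟨L, hL, hreg, hsup⟩ := hl.exists_lift
  rw [bot_sup_eq] at hsup
  -- The values p_ξ(ξ) lie in 𝔓 with leading form a power of ξ, and the homogeneous `reesQuot` is
  -- its own ideal of leading forms.
  have hgr : GradeGE 𝔓 (reesQuot (J.map (algebraMap B B')) ⊥) L.length := by
    refine gradeGE_of_leadIdeal (by rwa [leadIdeal_reesQuot]) fun ξ hξ => ?_
    obtain ⟨x, hx, hξx⟩ := exists_val_eq_of_map_val_eq hL ξ hξ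
    refine ⟨(p ξ).natDegree, x ^ (p ξ).natDegree, Ideal.pow_mem_pow (hl.mem x hx) _, aeval ξ (p ξ),
      hpP ξ, (p ξ).natDegree, ?_, ?_, fun m hm => ?_⟩
    · apply Subtype.ext
      rw [SubmonoidClass.coe_pow, hξx, reesMonomial_val, monomial_pow, one_mul]
    · rw [coeff_aeval_of_val_eq_monomial hξx, (hp ξ).coeff_natDegree, one_mul]
    · rw [coeff_aeval_of_val_eq_monomial hξx, coeff_eq_zero_of_natDegree_lt hm, zero_mul]
  have h𝔓 : 𝔓 ≠ ⊤ := fun htop => hP.ne_top (by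
    rw [← Ideal.comap_map_eq_self_of_faithfullyFlat (B := R') P]
    exact (congrArg (Ideal.comap _) htop).trans Ideal.comap_top)
  rw [← reesQuot_bot_map] at hgr
  have hgr' : GradeGE P (reesQuot J ⊥) L.length := GradeGE.of_map_of_flat h𝔓 hgr
  refine ⟨L.length, le_antisymm ?_ (hgr'.le_height hQP), hgr'⟩
  obtain ⟨P', hP', hle⟩ := Ideal.exists_le_maximal 𝔓 h𝔓
  refine (height_map_mk_le_card hQP (S := R') hle
    (L.toFinset.image fun ξ => aeval ξ (p ξ)) ?_ ?_).trans ?_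
  · intro f hf
    obtain ⟨ξ, -, rfl⟩ := Finset.mem_image.1 hf
    exact hle (hpP ξ)
  · intro 𝔭 h𝔭 hQ𝔭 hF
    have hs' : maximalIdeal B' ^ s ≤ J.map (algebraMap B B') := by
      rw [← h, ← Ideal.map_pow]
      exact Ideal.map_mono hs
    rw [reesQuot_bot_map] at hQ𝔭
    refine isMaximal_of_isIntegral_of_reesQuot hs' hL hsup hN 𝔭 hQ𝔭 fun ξ hξ => ⟨p ξ, hp ξ, ?_⟩
    have h1 := Ideal.Quotient.eq_zero_iff_mem.2
      (hF _ (Finset.mem_image_of_mem _ (List.mem_toFinset.2 hξ)))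
    rw [← h1]
    exact aeval_algHom_apply (Ideal.Quotient.mkₐ B' 𝔭) ξ (p ξ)
  · exact_mod_cast Finset.card_image_le.trans (List.toFinset_card_le L)

end AssociatedGraded

end RelHilbert

/-! ### Comparison over a single local ring -/

namespace RelHilbert

open Polynomial IsLocalRing

section LocalComparison

theorem hilbertCoeff_map {B : Type*} [CommRing B] [IsLocalRing B] (B' : Type*) [CommRing B']
    [IsLocalRing B'] [Algebra B B'] [Module.Flat B B'] [IsLocalHom (algebraMap B B')]
    (h : (maximalIdeal B).map (algebraMap B B') = maximalIdeal B') (J : Ideal B) (d i : ℕ) :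
    hilbertCoeff (J.map (algebraMap B B')) B' d i = hilbertCoeff J B d i := by
  have : lengthSeries (J.map (algebraMap B B')) ⊥ = lengthSeries J ⊥ := by
    simp only [lengthSeries, sup_bot_eq, ← Ideal.map_pow, idealLength_map B' h]
  rw [hilbertCoeff, hilbertCoeff, hSeries_eq, hSeries_eq, this]

/-- When M extends to a prime, the fibre contributes height zero to the height formula for flat
extensions. -/
theorem height_map_mk_eq {R S : Type*} [CommRing R] [IsNoetherianRing R] [CommRing S]
    [IsNoetherianRing S] [Algebra R S] [Module.Flat R S] {Q M : Ideal R} [hM : M.IsMaximal]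
    (hQM : Q ≤ M) (hP : (M.map (algebraMap R S)).IsPrime) :
    ((M.map (algebraMap R S)).map (Ideal.Quotient.mk (Q.map (algebraMap R S)))).height =
      (M.map (Ideal.Quotient.mk Q)).height := by
  have hflat : Module.Flat (R ⧸ Q) (S ⧸ Q.map (algebraMap R S)) := flat_quotient_map Q
  have hcM : (M.map (Ideal.Quotient.mk Q)).comap (Ideal.Quotient.mk Q) = M := by
    rw [Ideal.comap_map_of_surjective' _ Ideal.Quotient.mk_surjective, Ideal.mk_ker,
      sup_eq_left.2 hQM]
  have hMmax : (M.map (Ideal.Quotient.mk Q)).IsMaximal := by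
    refine (Ideal.map_eq_top_or_isMaximal_of_surjective _ Ideal.Quotient.mk_surjective
      hM).resolve_left fun htop => hM.ne_top ?_
    rw [← hcM, htop, Ideal.comap_top]
  have hmap : (M.map (Ideal.Quotient.mk Q)).map (algebraMap (R ⧸ Q) (S ⧸ Q.map (algebraMap R S))) =
      (M.map (algebraMap R S)).map (Ideal.Quotient.mk (Q.map (algebraMap R S))) := by
    rw [Ideal.map_map, Ideal.map_map]
    rfl
  have hPpr : ((M.map (Ideal.Quotient.mk Q)).map
      (algebraMap (R ⧸ Q) (S ⧸ Q.map (algebraMap R S)))).IsPrime := by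
    rw [hmap]
    exact Ideal.map_isPrime_of_surjective Ideal.Quotient.mk_surjective
      (by rw [Ideal.mk_ker]; exact Ideal.map_mono hQM)
  rw [← hmap]
  generalize M.map (Ideal.Quotient.mk Q) = p at hMmax hPpr ⊢
  have hover : (p.map (algebraMap (R ⧸ Q) (S ⧸ Q.map (algebraMap R S)))).LiesOver p :=
    ⟨hMmax.eq_of_le (Ideal.IsPrime.ne_top inferInstance) Ideal.le_comap_map⟩
  rw [Ideal.height_eq_height_add_of_liesOver_of_hasGoingDown p, Ideal.map_quotient_self,
    Ideal.height_bot, add_zero]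

/-- The case `A = B` of the comparison of the first Hilbert coefficients. -/
theorem hilbertCoeff_one_comparison_of_associatedGraded {B : Type*} [CommRing B]
    [IsNoetherianRing B] [IsLocalRing B] {d : ℕ} (hd : ringKrullDim B = d) {K J : Ideal B}
    (hKJ : K ≤ J) (hJ : J ≤ maximalIdeal B) {m : ℕ} (hm : K * J ^ m = J ^ (m + 1)) {s : ℕ}
    (hs : maximalIdeal B ^ s ≤ K) (hGr : IsCohenMacaulayRing (AssociatedGraded K)) :
    (idealLength K : ℤ) - idealLength J ≤ hilbertCoeff J B d 1 - hilbertCoeff K B d 1 ∧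
      (hilbertCoeff J B d 1 - hilbertCoeff K B d 1 = (idealLength K : ℤ) - idealLength J →
        IsCohenMacaulayRing (AssociatedGraded J)) := by
  let B' := ResidueExtension B
  have : Module.Flat B B' := residueExtension_flat B
  have : IsNoetherianRing B' := residueExtension_isNoetherianRing B
  have : IsLocalHom (algebraMap B B') := residueExtension_isLocalHom B
  have : Infinite (ResidueField B') := residueExtension_infinite B
  have : Module.FaithfullyFlat B B' := Module.FaithfullyFlat.of_flat_of_isLocalHom
  have h : (maximalIdeal B).map (algebraMap B B') = maximalIdeal B' :=
    map_maximalIdeal_residueExtension B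
  have hKJ' : (K.map (algebraMap B B')) ≤ (J.map (algebraMap B B')) := Ideal.map_mono hKJ
  have hm' : (K.map (algebraMap B B')) * (J.map (algebraMap B B')) ^ m = (J.map (algebraMap B B')) ^ (m + 1) := by
    rw [← Ideal.map_pow, ← Ideal.map_pow, ← Ideal.map_mul, hm]
  have hs' : maximalIdeal B' ^ s ≤ (K.map (algebraMap B B')) := by
    rw [← h, ← Ideal.map_pow]
    exact Ideal.map_mono hs
  have hK' : (K.map (algebraMap B B')) ≤ maximalIdeal B' := by
    rw [← h]
    exact Ideal.map_mono (hKJ.trans hJ)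
  have hKflat := rees_flat B' K
  change IsCohenMacaulayRing (reesAlgebra K ⧸ K.map (algebraMap B (reesAlgebra K))) at hGr
  rw [← reesQuot_bot, isCohenMacaulayRing_quotient_iff] at hGr
  have hQM : reesQuot K ⊥ ≤ reesMax K (maximalIdeal B) :=
    reesQuot_le_reesMax (hKJ.trans hJ) bot_le
  -- The hypothesis on Gr_K is used only at the irrelevant maximal ideal, where grade equals height.
  obtain ⟨c, hc, hgr⟩ := hGr _ (reesMax_isMaximal K (maximalIdeal B)) hQM
  have hgr' := hgr.map_of_flat (S := reesAlgebra (K.map (algebraMap B B')))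
  rw [reesMax_map, reesQuot_bot_map, h] at hgr'
  obtain ⟨l, hl, hlK, hlJ⟩ := exists_filSupSeq hKJ' hm' hs' hgr'
  have hmax : ((reesMax (K.map (algebraMap B B')) (maximalIdeal B')).map (Ideal.Quotient.mk (reesQuot (K.map (algebraMap B B')) ⊥))).height ≤
      l.length := by
    have hM := reesMax_isMaximal K (maximalIdeal B)
    have hM' := reesMax_isMaximal (K.map (algebraMap B B')) (maximalIdeal B')
    have h3 := height_map_mk_eq (S := reesAlgebra (K.map (algebraMap B B'))) hQM
      (by rw [reesMax_map, h]; exact hM'.isPrime)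
    rw [reesMax_map, reesQuot_bot_map, h] at h3
    rw [h3, hc, hl]
  obtain ⟨N, hN⟩ := hlK.exists_pow_le hK' hmax
  have hld : l.length = d := by
    have h1 := hlK.ringKrullDim_eq hK' hs' hN
    rw [ringKrullDim_eq_of_map_maximalIdeal B' h, hd] at h1
    exact_mod_cast h1.symm
  obtain ⟨h1, h2⟩ := hilbertCoeff_one_comparison hKJ' hm' hs' hlK hlJ hN
  rw [hld, hilbertCoeff_map B' h, hilbertCoeff_map B' h, idealLength_map B' h,
    idealLength_map B' h] at h1 h2
  exact ⟨h1, fun heq => isCohenMacaulayRing_associatedGraded h (hs.trans hKJ) (h2 heq)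
    ((pow_le_pow_of_reduction hm' N).trans hN)⟩

end LocalComparison

end RelHilbert

/-! ### Lengths along a finite local homomorphism -/

namespace RelHilbert

open Polynomial IsLocalRing

section RelativeLengths

variable {A B : Type*} [CommRing A] [IsLocalRing A] [CommRing B] [IsLocalRing B] [Algebra A B]
  [IsLocalHom (algebraMap A B)] [Module.Finite A B]

/-- Each composition factor over B is the residue field of B, whose A-length is δ. -/
theorem toNat_length_restrictScalars (M : Type*) [AddCommGroup M] [Module A M] [Module B M]
    [IsScalarTower A B M] : (Module.length A M).toNat =
      Module.finrank (ResidueField A) (ResidueField B) * (Module.length B M).toNat := by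
  rw [IsLocalRing.length_restrictScalars A B M,
    Module.length_eq_finrank (ResidueField A) (ResidueField B), ENat.toNat_mul, ENat.toNat_natCast,
    mul_comm]

theorem hilbertSamuel_eq_finrank_mul (I : Ideal A) (n : ℕ) :
    hilbertSamuel I B n = Module.finrank (ResidueField A) (ResidueField B) *
      hilbertSamuel (I.map (algebraMap A B)) B n := by
  have h : I ^ (n + 1) • (⊤ : Submodule A B) =
      (I.map (algebraMap A B) ^ (n + 1) • (⊤ : Ideal B)).restrictScalars A := by
    rw [Ideal.smul_top_eq_map, Ideal.map_pow, smul_eq_mul, Ideal.mul_top]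
  rw [hilbertSamuel, hilbertSamuel, ← toNat_length_restrictScalars (A := A), h,
    (Submodule.Quotient.restrictScalarsEquiv A
      (I.map (algebraMap A B) ^ (n + 1) • (⊤ : Ideal B))).length_eq]

theorem hilbertCoeff_eq_finrank_mul (I : Ideal A) (d i : ℕ) :
    hilbertCoeff I B d i = Module.finrank (ResidueField A) (ResidueField B) *
      hilbertCoeff (I.map (algebraMap A B)) B d i := by
  have h : hSeries I B d = PowerSeries.C
      (Module.finrank (ResidueField A) (ResidueField B) : ℤ) *
        hSeries (I.map (algebraMap A B)) B d := by
    rw [hSeries, hSeries, mul_left_comm]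
    congr 1
    ext n
    rw [PowerSeries.coeff_mk, PowerSeries.coeff_C_mul, PowerSeries.coeff_mk,
      hilbertSamuel_eq_finrank_mul]
    push_cast
    rfl
  rw [hilbertCoeff, hilbertCoeff, mul_finsum, h]
  refine finsum_congr fun k => ?_
  rw [PowerSeries.coeff_C_mul, mul_left_comm]

theorem relLength_eq_finrank_mul [IsNoetherianRing B] {I : Ideal A} {J : Ideal B} {s : ℕ}
    (hs : maximalIdeal B ^ s ≤ I.map (algebraMap A B)) (hle : I.map (algebraMap A B) ≤ J) :
    (relLength I J : ℤ) = Module.finrank (ResidueField A) (ResidueField B) *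
      ((idealLength (I.map (algebraMap A B)) : ℤ) - idealLength J) := by
  have h1 : relLength I J = Module.finrank (ResidueField A) (ResidueField B) *
      (Module.length B (J ⧸ (I.map (algebraMap A B)).submoduleOf J)).toNat :=
    toNat_length_restrictScalars _
  have h2 : idealLength (I.map (algebraMap A B)) =
      (Module.length B (J ⧸ (I.map (algebraMap A B)).submoduleOf J)).toNat + idealLength J := by
    have h3 := length_quotient_eq_add hle
    have h4 := length_quotient_ne_top hs
    rw [h3] at h4
    rw [idealLength, h3, ENat.toNat_add (fun h => h4 (by rw [h, top_add]))
      (fun h => h4 (by rw [h, add_top])), idealLength]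
  rw [h1, h2]
  push_cast
  ring

end RelativeLengths

end RelHilbert

/-! ### Reduction of the relative statement to B. -/

theorem theorem2p1 {A B : Type*} [CommRing A] [IsLocalRing A] [CommRing B] [IsLocalRing B]
    [Algebra A B] [IsLocalHom (algebraMap A B)] [Module.Finite A B]
    (hA : RelHilbert.IsCohenMacaulayLocalRing A) (hB : RelHilbert.IsCohenMacaulayLocalRing B)
    (d : ℕ) (hdA : ringKrullDim A = d) (hdB : ringKrullDim B = d)
    (I : Ideal A) (J : Ideal B)
    (hI : RelHilbert.IsPrimaryToMaximal I) (hJ : RelHilbert.IsPrimaryToMaximal J)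
    (hred : RelHilbert.IsReduction (I.map (algebraMap A B)) J)
    (hGr : RelHilbert.IsCohenMacaulayRing
      (RelHilbert.AssociatedGraded (I.map (algebraMap A B)))) :
    (Module.finrank (IsLocalRing.ResidueField A) (IsLocalRing.ResidueField B) : ℤ) *
        RelHilbert.hilbertCoeff J B d 1 ≥
      RelHilbert.hilbertCoeff I B d 1 + (RelHilbert.relLength I J : ℤ) ∧
    ((Module.finrank (IsLocalRing.ResidueField A) (IsLocalRing.ResidueField B) : ℤ) *
        RelHilbert.hilbertCoeff J B d 1 =
      RelHilbert.hilbertCoeff I B d 1 + (RelHilbert.relLength I J : ℤ) →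
      RelHilbert.IsCohenMacaulayRing (RelHilbert.AssociatedGraded J)) := by
  have hN : IsNoetherianRing B := hB.1
  obtain ⟨hKJ, m, hm⟩ := hred
  obtain ⟨s, hs⟩ := Ideal.exists_pow_le_of_le_radical_of_fg hJ.2.ge (IsNoetherian.noetherian _)
  -- A power of the maximal ideal lies in J, and Jᵐ⁺¹ = IB·Jᵐ lies in IB.
  have hs' : IsLocalRing.maximalIdeal B ^ (s * (m + 1)) ≤ I.map (algebraMap A B) := by
    rw [pow_mul]
    refine (Ideal.pow_right_mono hs _).trans ?_
    rw [← hm]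
    exact Ideal.mul_le_left (I := I.map (algebraMap A B))
  have hJm : J ≤ IsLocalRing.maximalIdeal B := hJ.2 ▸ Ideal.le_radical
  obtain ⟨h1, h2⟩ :=
    RelHilbert.hilbertCoeff_one_comparison_of_associatedGraded hdB hKJ hJm hm hs' hGr
  have hδ : (0 : ℤ) < Module.finrank (IsLocalRing.ResidueField A) (IsLocalRing.ResidueField B) := by
    exact_mod_cast Module.finrank_pos
  rw [RelHilbert.hilbertCoeff_eq_finrank_mul I, RelHilbert.relLength_eq_finrank_mul hs' hKJ, ← mul_add]
  refine ⟨mul_le_mul_of_nonneg_left (by linarith) hδ.le, fun heq => h2 ?_⟩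
  linarith [mul_left_cancel₀ hδ.ne' heq]
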